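/- Let $(X,\mathcal B,m)$ be a measure space with $m$ localizable, i.e. $m$ is semi-finite and every family of measurable sets has an essential supremum. Let $L^0(m)$ be the space of $m$-a.e. classes of real-valued measurable functions, with the topology of local convergence in measure, which is generated by the pseudometrics $d_U(f,g)=\int_U \min(|f-g|,1)\,dm$, $m(U)<\infty$. A quadratic form on $L^0(m)$ is a map $E:L^0(m)\to[0,\infty]$ with $2E(f)+2E(g)=E(f-g)+E(f+g)$ and $E(\lambda f)=|\lambda|^2E(f)$ (with $0\cdot\infty=0$); its domain is $D(E)=\{f : E(f)<\infty\}$, and the form topology on $D(E)$ is the smallest topology containing the topology induced from $L^0(m)$ and that of the seminorm $E^{1/2}$. A form $\widetilde E$ is an extension of $E$ if $D(E)\subseteq D(\widetilde E)$ and $\widetilde E=E$ on $D(E)$. An energy form is a quadratic form $E$ on $L^0(m)$ that is closed, i.e. $D(E)$ with the form topology is complete, and Markovian, i.e. for every $\varepsilon>0$ there is an increasing $C_\varepsilon:\mathbb R\to[-\varepsilon,1+\varepsilon]$ with $|C_\varepsilon(s)-C_\varepsilon(t)|\le|s-t|$ for all $s,t$ and $C_\varepsilon(t)=t$ for $t\in[0,1]$,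 such that $E(C_\varepsilon\circ f)\le E(f)$ for all $f\in L^0(m)$. A collection $\mathcal N$ of measurable sets is an $E$-nest if $D(E)_{\mathcal N}=\{f\in D(E) : f1_{X\setminus N}=0 \text{ for some } N\in\mathcal N\}$ is a linear subspace that is dense in $D(E)$ with respect to the form topology. It is special if for each $N\in\mathcal N$ there is $g\in D(E)_{\mathcal N}$ with $g\ge 1_N$. Put $$D(E)_{\mathrm{loc},\mathcal N}=\{f\in L^0(m) : \text{for all } N\in\mathcal N \text{ there is } f_N\in D(E)\text{ with } f1_N=f_N1_N\},\qquad D(E)_{\mathrm{loc}}=\bigcup_{\mathcal N\ E\text{-nest}}D(E)_{\mathrm{loc},\mathcal N}.$$ For $A,B\subseteq L^0(m)$, $A$ is an order ideal in $B$ if $f\in A$, $g\in B$, $|g|\le|f|$ imply $g\in A$, and an algebraic ideal in $B$ if $fg\in A$ for all $f\in A$, $g\in B$. **Theorem.** Let $E$ and $\widetilde E$ be energy forms on $L^0(m)$ such that $\widetilde E$ is an extension of $E$. The following assertions are equivalent. (i) $D(E)$ is an order ideal in $D(\widetilde E)$. (ii) $D(E)\cap L^\infty(m)$ is an algebraic ideal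 in $D(\widetilde E)\cap L^\infty(m)$. (iii) $D(\widetilde E)\subseteq D(E)_{\mathrm{loc}}$. (iv) There exists a special $E$-nest $\mathcal N$ such that $D(\widetilde E)\cap L^\infty(m)\subseteq D(E)_{\mathrm{loc},\mathcal N}$. (v) For every special $E$-nest $\mathcal N$, $D(\widetilde E)\cap L^\infty(m)\subseteq D(E)_{\mathrm{loc},\mathcal N}$. (An extension $\widetilde E$ with these equivalent properties is called a Silverstein extension of $E$.) -/

import Mathlib

open MeasureTheory Set
open scoped ENNReal

noncomputable section

namespace EnergyForm

/-! ### Localizable measures and the topology of local convergence in measure -/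

section Lebesgue

variable {X : Type*} [MeasurableSpace X]

/-- A measure is localizable if it is semi-finite and every family of measurable sets has an
essential supremum. -/
structure IsLocalizable (m : Measure X) : Prop where
  semifinite : ∀ A : Set X, MeasurableSet A → m A = ∞ →
    ∃ A' : Set X, A' ⊆ A ∧ MeasurableSet A' ∧ 0 < m A' ∧ m A' < ∞
  exists_essSup : ∀ 𝒜 : Set (Set X), (∀ A ∈ 𝒜, MeasurableSet A) →
    ∃ S : Set X, MeasurableSet S ∧ (∀ A ∈ 𝒜, m (A \ S) = 0) ∧
      ∀ G : Set X, MeasurableSet G → (∀ A ∈ 𝒜, m (A \ G) = 0) → m (S \ G) = 0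

/-- The pseudometric `d_U(f, g) = ∫_U min(|f - g|, 1) dm` on `L⁰(m)`, for `m U < ∞`. -/
@[reducible] def localPseudoMetric (m : Measure X) (U : Set X) (hU : m U < ∞) :
    PseudoMetricSpace (X →ₘ[m] ℝ) where
  dist f g := ∫ x in U, min |f x - g x| 1 ∂m
  dist_self f := by simp
  dist_comm f g := by simp only [abs_sub_comm]
  dist_triangle f g h := by
    have : IsFiniteMeasure (m.restrict U) := ⟨by simpa using hU⟩
    have hi : ∀ f g : X →ₘ[m] ℝ, Integrable (fun x => min |f x - g x| 1) (m.restrict U) := by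
      intro f g
      refine Integrable.of_bound (C := 1) ?_ ?_
      · have hf : AEStronglyMeasurable f (m.restrict U) := f.aestronglyMeasurable.restrict
        have hg : AEStronglyMeasurable g (m.restrict U) := g.aestronglyMeasurable.restrict
        exact (hf.sub hg).norm.inf aestronglyMeasurable_const
      · refine Filter.Eventually.of_forall fun x => ?_
        rw [Real.norm_eq_abs, abs_of_nonneg (le_min (abs_nonneg _) zero_le_one)]
        exact min_le_right _ _
    rw [← integral_add (hi f g) (hi g h)]
    refine integral_mono (hi f h) ((hi f g).add (hi g h)) fun x => ?_
    have h1 := abs_sub_le (f x) (g x) (h x)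
    have h2 := abs_nonneg (f x - g x)
    have h3 := abs_nonneg (g x - h x)
    rcases min_cases |f x - h x| 1 with h4 | h4 <;>
    rcases min_cases |f x - g x| 1 with h5 | h5 <;>
    rcases min_cases |g x - h x| 1 with h6 | h6 <;>
    simp only [h4.1, h5.1, h6.1] <;> linarith

/-- The uniform structure of local convergence in measure on `L⁰(m)`: the coarsest one that
refines those of all `d_U` with `U` measurable of finite measure. Its topology is `τ(m)`. -/
@[reducible] def localMeasureUniformSpace (m : Measure X) : UniformSpace (X →ₘ[m] ℝ) :=
  ⨅ U : {U : Set X // MeasurableSet U ∧ m U < ∞},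
    (localPseudoMetric m U.1 U.2.2).toUniformSpace

/-- `L^∞(m)` as a set of elements of `L⁰(m)`. -/
def essBounded (m : Measure X) : Set (X →ₘ[m] ℝ) := (Lp ℝ ∞ m : Set (X →ₘ[m] ℝ))

/-- `A` is an order ideal in `B`. -/
def IsOrderIdealIn {m : Measure X} (A B : Set (X →ₘ[m] ℝ)) : Prop :=
  ∀ f ∈ A, ∀ g ∈ B, |g| ≤ |f| → g ∈ A

/-- `A` is an algebraic ideal in `B`. -/
def IsAlgebraicIdealIn {m : Measure X} (A B : Set (X →ₘ[m] ℝ)) : Prop :=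
  ∀ f ∈ A, ∀ g ∈ B, f * g ∈ A

end Lebesgue

/-! ### Quadratic forms -/

/-- A (positive) quadratic form on a real vector space, with values in `[0, ∞]`. -/
structure QForm (V : Type*) [AddCommGroup V] [Module ℝ V] where
  toFun : V → ℝ≥0∞
  parallelogram : ∀ u v, 2 * toFun u + 2 * toFun v = toFun (u - v) + toFun (u + v)
  homogeneous : ∀ (c : ℝ) (u : V), toFun (c • u) = ENNReal.ofReal (|c| ^ 2) * toFun u

namespace QForm

section Basics

variable {V : Type*} [AddCommGroup V] [Module ℝ V]

instance : CoeFun (QForm V) fun _ => V → ℝ≥0∞ := ⟨QForm.toFun⟩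

/-- The domain `D(q) = {u | q(u) < ∞}`. -/
def domain (q : QForm V) : Submodule ℝ V where
  carrier := {u | q u < ∞}
  zero_mem' := by
    have h : q 0 = 0 := by
      have h := q.homogeneous 0 0
      rw [smul_zero, abs_zero, zero_pow two_ne_zero, ENNReal.ofReal_zero, zero_mul] at h
      exact h
    change q 0 < ∞
    rw [h]
    exact ENNReal.zero_lt_top
  add_mem' {u v} hu hv := by
    have h := q.parallelogram u v
    have h2 : 2 * q u + 2 * q v < ∞ :=
      ENNReal.add_lt_top.2 ⟨ENNReal.mul_lt_top (by simp) hu, ENNReal.mul_lt_top (by simp) hv⟩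
    rw [h] at h2
    exact (ENNReal.add_lt_top.1 h2).2
  smul_mem' c u hu := by
    have h := q.homogeneous c u
    change q (c • u) < ∞
    rw [h]
    exact ENNReal.mul_lt_top ENNReal.ofReal_lt_top hu

/-- `q̃` is an extension of `q`. -/
def IsExtension (q' q : QForm V) : Prop :=
  q.domain ≤ q'.domain ∧ ∀ u ∈ q.domain, q u = q' u

/-- The triangle inequality for a function satisfying the parallelogram identity and
homogeneity. -/
theorem sqrt_triangle {W : Type*} [AddCommGroup W] [Module ℝ W] (Q : W → ℝ)
    (h0 : ∀ u, 0 ≤ Q u) (hp : ∀ u v, 2 * Q u + 2 * Q v = Q (u - v) + Q (u + v))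
    (hs : ∀ (c : ℝ) u, Q (c • u) = c ^ 2 * Q u) (u v : W) :
    √(Q (u + v)) ≤ √(Q u) + √(Q v) := by
  have key : ∀ t s : ℝ, 2 * Q (u + t • v) + 2 * (s ^ 2 * Q v)
      = Q (u + (t - s) • v) + Q (u + (t + s) • v) := by
    intro t s
    have := hp (u + t • v) (s • v)
    rw [hs] at this
    rw [this, sub_smul, add_smul, add_sub_assoc, add_assoc]
  obtain ⟨h, hh⟩ : ∃ h : ℝ → ℝ, ∀ t, h t = Q (u + t • v) - t ^ 2 * Q v - Q u := ⟨_, fun _ => rfl⟩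
  have hz : h 0 = 0 := by simp [hh]
  have hj : ∀ t s, h (t - s) + h (t + s) = 2 * h t := by
    intro t s
    have := key t s
    simp only [hh]
    linarith [mul_comm (Q v) 1]
  have hd : ∀ t, h (t + t) = 2 * h t := by
    intro t
    have := hj t t
    rw [sub_self, hz] at this
    linarith
  have hadd : ∀ a b, h (a + b) = h a + h b := by
    intro a b
    have h1 := hj ((a + b) / 2) ((a - b) / 2)
    have h2 := hd ((a + b) / 2)
    rw [show (a + b) / 2 - (a - b) / 2 = b by ring,
      show (a + b) / 2 + (a - b) / 2 = a by ring] at h1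
    rw [add_halves] at h2
    linarith
  have hrat : ∀ r : ℚ, h (r : ℝ) = r * h 1 := by
    intro r
    have := map_rat_smul (AddMonoidHom.mk' h hadd) r (1 : ℝ)
    simpa [Rat.smul_def] using this
  have hnon : ∀ t : ℝ, 0 ≤ Q v * (t * t) + h 1 * t + Q u := by
    intro t
    refine Rat.denseRange_cast.induction_on (p := fun t : ℝ => 0 ≤ Q v * (t * t) + h 1 * t + Q u)
      t (isClosed_le continuous_const (by fun_prop)) fun r => ?_
    have h1 := hh r
    rw [hrat] at h1
    have h2 := h0 (u + (r : ℝ) • v)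
    nlinarith
  have hdisc := discrim_le_zero hnon
  rw [discrim] at hdisc
  have h1 : Q (u + v) = Q u + h 1 + Q v := by
    have := hh 1
    rw [one_smul] at this
    linarith
  have hu := Real.sq_sqrt (h0 u)
  have hv := Real.sq_sqrt (h0 v)
  have hu0 := Real.sqrt_nonneg (Q u)
  have hv0 := Real.sqrt_nonneg (Q v)
  rw [Real.sqrt_le_left (by positivity), h1]
  have : h 1 ≤ 2 * (√(Q u) * √(Q v)) := by
    refine abs_le_of_sq_le_sq' ?_ (by positivity) |>.2
    calc h 1 ^ 2 ≤ 4 * (Q u * Q v) := by linarith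
      _ = (2 * (√(Q u) * √(Q v))) ^ 2 := by rw [mul_pow, mul_pow, hu, hv]; ring
  nlinarith

/-- The form seminorm `‖u‖_q = q(u)^{1/2}` on `D(q)`. -/
def formSeminorm (q : QForm V) : Seminorm ℝ q.domain :=
  have hs : ∀ (c : ℝ) (u : q.domain),
      (q ((c • u : q.domain) : V)).toReal = c ^ 2 * (q (u : V)).toReal := by
    intro c u
    rw [Submodule.coe_smul, q.homogeneous, ENNReal.toReal_mul, ENNReal.toReal_ofReal (by positivity),
      sq_abs]
  Seminorm.of (fun u => √((q (u : V)).toReal))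
    (sqrt_triangle (fun u : q.domain => (q (u : V)).toReal) (fun _ => ENNReal.toReal_nonneg)
      (fun u v => by
        have h := congrArg ENNReal.toReal (q.parallelogram (u : V) v)
        have hu : q (u : V) ≠ ∞ := ne_of_lt u.2
        have hv : q (v : V) ≠ ∞ := ne_of_lt v.2
        have h1 : q ((u : V) - v) ≠ ∞ := ne_of_lt (q.domain.sub_mem u.2 v.2)
        have h2 : q ((u : V) + v) ≠ ∞ := ne_of_lt (q.domain.add_mem u.2 v.2)
        rw [ENNReal.toReal_add (ENNReal.mul_ne_top (by simp) hu) (ENNReal.mul_ne_top (by simp) hv),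
          ENNReal.toReal_add h1 h2, ENNReal.toReal_mul, ENNReal.toReal_mul] at h
        simpa using h)
      hs)
    (fun c u => by
      rw [hs, Real.sqrt_mul (sq_nonneg c), Real.sqrt_sq_eq_abs, Real.norm_eq_abs])

/-- The uniform structure of the form topology `τ_q` on `D(q)`: generated by the one induced
from the ambient space and the one of the form seminorm. -/
@[reducible] def formUniformSpace (q : QForm V) (𝒰 : UniformSpace V) : UniformSpace q.domain :=
  𝒰.comap (Subtype.val : q.domain → V) ⊓
    q.formSeminorm.toSeminormedAddCommGroup.toPseudoMetricSpace.toUniformSpace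

/-- The form topology `τ_q` on `D(q)`. -/
@[reducible] def formTopology (q : QForm V) (𝒰 : UniformSpace V) : TopologicalSpace q.domain :=
  (q.formUniformSpace 𝒰).toTopologicalSpace

/-- `q` is closed if `D(q)` with the form topology is complete. -/
def IsClosedForm (q : QForm V) (𝒰 : UniformSpace V) : Prop :=
  @CompleteSpace q.domain (q.formUniformSpace 𝒰)

end Basics

end QForm

/-! ### Energy forms -/

/-- Normal contractions of the real line. -/
structure IsNormalContraction (C : ℝ → ℝ) : Prop where
  map_zero : C 0 = 0
  abs_sub_le : ∀ x y, |C x - C y| ≤ |x - y|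

theorem IsNormalContraction.continuous {C : ℝ → ℝ} (hC : IsNormalContraction C) : Continuous C :=
  (LipschitzWith.of_dist_le_mul (K := 1) fun x y => by
    simpa [Real.dist_eq] using hC.abs_sub_le x y).continuous

/-- `ε`-cutoffs. -/
structure IsCutoff (ε : ℝ) (C : ℝ → ℝ) : Prop extends IsNormalContraction C where
  monotone : Monotone C
  mem_Icc : ∀ x, C x ∈ Icc (-ε) (1 + ε)
  eq_self : ∀ x ∈ Icc (0 : ℝ) 1, C x = x

section Forms

variable {X : Type*} [MeasurableSpace X] {m : Measure X}

/-- Markovian quadratic forms on `L⁰(m)`. -/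
def IsMarkovian (E : QForm (X →ₘ[m] ℝ)) : Prop :=
  ∀ ε : ℝ, 0 < ε → ∃ (C : ℝ → ℝ) (hC : IsCutoff ε C),
    ∀ f : X →ₘ[m] ℝ, E (f.comp C hC.continuous) ≤ E f

/-- Energy forms: closed Markovian forms on `L⁰(m)`. (The measure `m` is localizable.) -/
structure IsEnergyForm (E : QForm (X →ₘ[m] ℝ)) : Prop where
  closed : E.IsClosedForm (localMeasureUniformSpace m)
  markovian : IsMarkovian E

/-! ### Nests and local spaces -/

/-- `D(E)_𝒩`: the functions in `D(E)` that vanish (a.e.) outside some `N ∈ 𝒩`. -/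
def nestDomain (E : QForm (X →ₘ[m] ℝ)) (𝒩 : Set (Set X)) : Set (X →ₘ[m] ℝ) :=
  {f | f ∈ E.domain ∧ ∃ N ∈ 𝒩, ∀ᵐ x ∂m, x ∉ N → f x = 0}

/-- `E`-nests: collections `𝒩` of measurable sets such that `D(E)_𝒩` is a linear subspace that is
dense in `D(E)` with respect to the form topology. -/
structure IsNest (E : QForm (X →ₘ[m] ℝ)) (𝒩 : Set (Set X)) : Prop where
  measurableSet : ∀ N ∈ 𝒩, MeasurableSet N
  subspace : ∃ W : Submodule ℝ (X →ₘ[m] ℝ), (W : Set (X →ₘ[m] ℝ)) = nestDomain E 𝒩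
  dense : @Dense E.domain (E.formTopology (localMeasureUniformSpace m))
    {f : E.domain | (f : X →ₘ[m] ℝ) ∈ nestDomain E 𝒩}

/-- Special `E`-nests: for every `N ∈ 𝒩` there is `g ∈ D(E)_𝒩` with `g ≥ 1_N` a.e. -/
structure IsSpecialNest (E : QForm (X →ₘ[m] ℝ)) (𝒩 : Set (Set X)) : Prop
    extends IsNest E 𝒩 where
  exists_ge_one : ∀ N ∈ 𝒩, ∃ g ∈ nestDomain E 𝒩, ∀ᵐ x ∂m, N.indicator (fun _ => (1 : ℝ)) x ≤ g x

/-- The local space `D(E)_{loc, 𝒩}`. -/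
def localSpaceOn (E : QForm (X →ₘ[m] ℝ)) (𝒩 : Set (Set X)) : Set (X →ₘ[m] ℝ) :=
  {f | ∀ N ∈ 𝒩, ∃ fN ∈ E.domain, ∀ᵐ x ∂m, x ∈ N → f x = fN x}

/-- The local space `D(E)_loc`, the union of the `D(E)_{loc, 𝒩}` over all `E`-nests `𝒩`. -/
def localSpace (E : QForm (X →ₘ[m] ℝ)) : Set (X →ₘ[m] ℝ) :=
  {f | ∃ 𝒩 : Set (Set X), IsNest E 𝒩 ∧ f ∈ localSpaceOn E 𝒩}

end Forms

end EnergyForm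

end

open EnergyForm

noncomputable section

namespace EnergyForm

open Filter Topology

/-! ### Real-valued calculus of quadratic forms on their domain -/

namespace QForm

section Real

variable {V : Type*} [AddCommGroup V] [Module ℝ V] (q : QForm V)

/-! Everything rests on one consequence of closedness, `exists_mem_closure_of_locDist`: a local
limit in measure of elements of bounded energy has finite energy, and if the approximants come from
a midpoint-stable set, the limit lies in the form closure of that set. Near-minimizers of the energy
over shrinking neighbourhoods form a Cauchy net by the parallelogram identity, so neither weak
compactness nor Banach–Saks is needed. With the cutoffs this makes the domain of an energy form a
lattice stable under truncation, whose bounded elements form an algebra.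

The equivalence runs 1 → 2 → 5 → 4 → 1 together with 1 ↔ 3. An order ideal is an algebraic ideal
because |fg| ≤ ‖g‖_∞ |f|. An algebraic ideal localizes bounded functions: multiply by an element of
D(E) that equals 1 on N. For the way back (`IsNest.mem_domain_of_le`), let 0 ≤ g ≤ f with f ∈ D(E),
approximate f by u vanishing off some N in the nest, and replace g by g ∧ u⁺; this depends on g only
through its values on N, so it lies in D(E), and its energy is controlled by Ẽ. Unbounded g is
reached by truncation. For 1 → 3 the nest is adapted to the given function (`boundedNest`); the
order ideal property is what makes it a nest. The same construction with f = 0 and Ẽ = E yields a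
special nest. -/

theorem toReal_parallelogram {u v : V} (hu : u ∈ q.domain) (hv : v ∈ q.domain) :
    2 * (q u).toReal + 2 * (q v).toReal = (q (u - v)).toReal + (q (u + v)).toReal := by
  have h := congrArg ENNReal.toReal (q.parallelogram u v)
  have hu' : q u ≠ ∞ := ne_of_lt hu
  have hv' : q v ≠ ∞ := ne_of_lt hv
  have h1 : q (u - v) ≠ ∞ := ne_of_lt (q.domain.sub_mem hu hv)
  have h2 : q (u + v) ≠ ∞ := ne_of_lt (q.domain.add_mem hu hv)
  rw [ENNReal.toReal_add (ENNReal.mul_ne_top (by simp) hu')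
      (ENNReal.mul_ne_top (by simp) hv'),
    ENNReal.toReal_add h1 h2, ENNReal.toReal_mul, ENNReal.toReal_mul] at h
  simpa using h

theorem toReal_smul (c : ℝ) (u : V) : (q (c • u)).toReal = c ^ 2 * (q u).toReal := by
  rw [q.homogeneous, ENNReal.toReal_mul, ENNReal.toReal_ofReal (by positivity), sq_abs]

theorem toReal_add_le {u v : V} (hu : u ∈ q.domain) (hv : v ∈ q.domain) :
    (q (u + v)).toReal ≤ 2 * (q u).toReal + 2 * (q v).toReal := by
  rw [q.toReal_parallelogram hu hv]
  exact le_add_of_nonneg_left ENNReal.toReal_nonneg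

theorem toReal_sub_le {u v : V} (hu : u ∈ q.domain) (hv : v ∈ q.domain) :
    (q (u - v)).toReal ≤ 2 * (q u).toReal + 2 * (q v).toReal := by
  rw [q.toReal_parallelogram hu hv]
  exact le_add_of_nonneg_right ENNReal.toReal_nonneg

theorem formSeminorm_sq (u : q.domain) : q.formSeminorm u ^ 2 = (q (u : V)).toReal :=
  Real.sq_sqrt ENNReal.toReal_nonneg

/-- Sublevel sets of a quadratic form are stable under finite averages. -/
theorem toReal_average_le {n : ℕ} (hn : 0 < n) {f : ℕ → V} {c : ℝ} (hf : ∀ i, f i ∈ q.domain)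
    (hc : ∀ i, (q (f i)).toReal ≤ c) :
    (q ((n : ℝ)⁻¹ • ∑ i ∈ Finset.range n, f i)).toReal ≤ c := by
  have hc0 : 0 ≤ c := ENNReal.toReal_nonneg.trans (hc 0)
  -- The bound is linear in the seminorm, so the triangle inequality is applied to square roots and
  -- squared only at the end.
  have key : ∀ k : ℕ, ∃ h : ∑ i ∈ Finset.range k, f i ∈ q.domain,
      q.formSeminorm ⟨_, h⟩ ≤ k * √c := by
    intro k
    induction k with
    | zero =>
      refine ⟨by simp, ?_⟩
      have : (⟨∑ i ∈ Finset.range 0, f i, by simp⟩ : q.domain) = 0 := by ext; simp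
      rw [this]; simp
    | succ k ih =>
      obtain ⟨h, hk⟩ := ih
      have h' : ∑ i ∈ Finset.range (k + 1), f i ∈ q.domain := by
        rw [Finset.sum_range_succ]; exact q.domain.add_mem h (hf k)
      refine ⟨h', ?_⟩
      have : (⟨_, h'⟩ : q.domain) = ⟨_, h⟩ + ⟨f k, hf k⟩ := by
        ext; simp [Finset.sum_range_succ]
      rw [this]
      refine (map_add_le_add _ _ _).trans ?_
      have h2 : q.formSeminorm ⟨f k, hf k⟩ ≤ √c := Real.sqrt_le_sqrt (hc k)
      push_cast
      linarith
  obtain ⟨h, hk⟩ := key n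
  have h1 := q.formSeminorm_sq ⟨_, h⟩
  have h0 : 0 ≤ q.formSeminorm ⟨_, h⟩ := apply_nonneg _ _
  have h2 : q.formSeminorm ⟨_, h⟩ ^ 2 ≤ (n * √c) ^ 2 := by gcongr
  rw [h1, mul_pow, Real.sq_sqrt hc0] at h2
  rw [toReal_smul, inv_pow, inv_mul_le_iff₀ (by positivity)]
  exact h2

end Real

end QForm

/-! ### The pseudometrics of local convergence in measure -/

section LocDist

variable {X : Type*} [MeasurableSpace X] {m : Measure X}

/-- The pseudometric `d_U`. -/
def locDist (m : Measure X) (U : Set X) (f g : X →ₘ[m] ℝ) : ℝ :=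
  ∫ x in U, min |f x - g x| 1 ∂m

theorem integrable_min_abs_sub {U : Set X} (hU : m U < ∞) (f g : X →ₘ[m] ℝ) :
    Integrable (fun x => min |f x - g x| 1) (m.restrict U) := by
  have : IsFiniteMeasure (m.restrict U) := ⟨by simpa using hU⟩
  refine Integrable.of_bound (C := 1) ?_ ?_
  · have hf : AEStronglyMeasurable f (m.restrict U) := f.aestronglyMeasurable.restrict
    have hg : AEStronglyMeasurable g (m.restrict U) := g.aestronglyMeasurable.restrict
    exact (hf.sub hg).norm.inf aestronglyMeasurable_const
  · refine Filter.Eventually.of_forall fun x => ?_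
    rw [Real.norm_eq_abs, abs_of_nonneg (le_min (abs_nonneg _) zero_le_one)]
    exact min_le_right _ _

theorem locDist_nonneg (U : Set X) (f g : X →ₘ[m] ℝ) : 0 ≤ locDist m U f g :=
  integral_nonneg fun _ => le_min (abs_nonneg _) zero_le_one

theorem locDist_triangle {U : Set X} (hU : m U < ∞) (f g h : X →ₘ[m] ℝ) :
    locDist m U f h ≤ locDist m U f g + locDist m U g h :=
  (localPseudoMetric m U hU).dist_triangle f g h

theorem locDist_comm (U : Set X) (f g : X →ₘ[m] ℝ) : locDist m U f g = locDist m U g f := by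
  simp only [locDist, abs_sub_comm]

theorem locDist_mono_set {U V : Set X} (hV : m V < ∞) (h : U ⊆ V) (f g : X →ₘ[m] ℝ) :
    locDist m U f g ≤ locDist m V f g :=
  setIntegral_mono_set (integrable_min_abs_sub hV f g)
    (ae_of_all _ fun _ => le_min (abs_nonneg _) zero_le_one) h.eventuallyLE

theorem locDist_mono {U : Set X} (hU : m U < ∞) {f g h k : X →ₘ[m] ℝ}
    (H : ∀ᵐ x ∂m, |f x - g x| ≤ |h x - k x|) : locDist m U f g ≤ locDist m U h k :=
  integral_mono_ae (integrable_min_abs_sub hU f g) (integrable_min_abs_sub hU h k)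
    ((ae_restrict_of_ae H).mono fun _ hx => min_le_min_right _ hx)

/-- The integrand min(|·|, 1) is not convex, so the factor 1/2 is given up; the loss is absorbed
later by halving the tolerance. -/
theorem locDist_midpoint {U : Set X} (hU : m U < ∞) (f h g : X →ₘ[m] ℝ) :
    locDist m U ((1 / 2 : ℝ) • (f + h)) g ≤ locDist m U f g + locDist m U h g := by
  rw [locDist, locDist, locDist,
    ← integral_add (integrable_min_abs_sub hU f g) (integrable_min_abs_sub hU h g)]
  refine integral_mono_ae (integrable_min_abs_sub hU _ g)
    ((integrable_min_abs_sub hU f g).add (integrable_min_abs_sub hU h g)) ?_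
  filter_upwards [ae_restrict_of_ae (AEEqFun.coeFn_smul (1 / 2 : ℝ) (f + h)),
    ae_restrict_of_ae (AEEqFun.coeFn_add f h)] with x h1 h2
  rw [h1, Pi.smul_apply, h2, Pi.add_apply, smul_eq_mul]
  have h3 := abs_add_le (f x - g x) (h x - g x)
  have h5 : |1 / 2 * (f x + h x) - g x| = 1 / 2 * |f x - g x + (h x - g x)| := by
    rw [← abs_of_pos (one_half_pos (α := ℝ)), ← abs_mul, abs_of_pos (one_half_pos (α := ℝ))]
    congr 1; ring
  have h4 := abs_nonneg (f x - g x)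
  have h6 := abs_nonneg (h x - g x)
  simp only [h5]
  rcases le_total |f x - g x| 1 with h7 | h7 <;> rcases le_total |h x - g x| 1 with h8 | h8
  · rw [min_eq_left h7, min_eq_left h8]
    exact (min_le_left _ _).trans (by linarith)
  · rw [min_eq_right h8, min_eq_left h7]
    exact (min_le_right _ _).trans (by linarith)
  · rw [min_eq_right h7, min_eq_left h8]
    exact (min_le_right _ _).trans (by linarith)
  · rw [min_eq_right h7, min_eq_right h8]
    exact (min_le_right _ _).trans (by linarith)

theorem tendsto_locDist_of_ae {U : Set X} (hU : m U < ∞) {f : ℕ → X →ₘ[m] ℝ} {g : X →ₘ[m] ℝ}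
    (h : ∀ᵐ x ∂m, Tendsto (fun n => f n x) atTop (𝓝 (g x))) :
    Tendsto (fun n => locDist m U (f n) g) atTop (𝓝 0) := by
  have : IsFiniteMeasure (m.restrict U) := ⟨by simpa using hU⟩
  have h0 : (0 : ℝ) = ∫ x in U, (fun _ => (0 : ℝ)) x ∂m := by simp
  rw [h0]
  refine tendsto_integral_of_dominated_convergence (fun _ => (1 : ℝ))
    (fun n => (integrable_min_abs_sub hU (f n) g).aestronglyMeasurable) (integrable_const _)
    (fun n => ae_of_all _ fun x => ?_) ?_
  · rw [Real.norm_eq_abs, abs_of_nonneg (le_min (abs_nonneg _) zero_le_one)]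
    exact min_le_right _ _
  · filter_upwards [ae_restrict_of_ae h] with x hx
    have h1 : Tendsto (fun n => min |f n x - g x| 1) atTop (𝓝 (min |g x - g x| 1)) :=
      ((hx.sub_const _).abs).min tendsto_const_nhds
    simpa using h1

/-- For semi-finite measures, the pseudometrics `d_U` separate points. -/
theorem eq_of_locDist_eq_zero (hm : IsLocalizable m) {f g : X →ₘ[m] ℝ}
    (h : ∀ U, MeasurableSet U → m U < ∞ → locDist m U f g = 0) : f = g := by
  have key : ∀ U, MeasurableSet U → m U < ∞ → U ⊆ {x | f x ≠ g x} → m U = 0 := by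
    intro U hU hfin hsub
    have h1 := (integral_eq_zero_iff_of_nonneg
      (fun _ => le_min (abs_nonneg _) zero_le_one) (integrable_min_abs_sub hfin f g)).1 (h U hU hfin)
    have h2 : ∀ᵐ x ∂m.restrict U, False := by
      filter_upwards [h1, ae_restrict_mem hU] with x hx hxU
      have h3 : 0 < |f x - g x| := abs_pos.2 (sub_ne_zero.2 (hsub hxU))
      exact (lt_min h3 one_pos).ne' hx
    simpa [ae_iff] using h2
  have hA : MeasurableSet {x | f x ≠ g x} :=
    (measurableSet_eq_fun f.measurable g.measurable).compl
  rw [AEEqFun.ext_iff]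
  change m {x | f x ≠ g x} = 0
  by_cases hfin : m {x | f x ≠ g x} = ∞
  · obtain ⟨A', hsub, hA', hpos, hlt⟩ := hm.semifinite _ hA hfin
    exact absurd (key A' hA' hlt hsub) hpos.ne'
  · exact key _ hA (lt_top_iff_ne_top.2 hfin) subset_rfl

/-! ### The form topology -/

variable {E : QForm (X →ₘ[m] ℝ)}

theorem tendsto_form_iff {ι : Type*} {l : Filter ι} {u : ι → E.domain} {g : E.domain} :
    Tendsto u l (@nhds _ (E.formTopology (localMeasureUniformSpace m)) g) ↔
      (∀ U, MeasurableSet U → m U < ∞ → Tendsto (fun i => locDist m U (u i) g) l (𝓝 0)) ∧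
      Tendsto (fun i => E.formSeminorm (u i - g)) l (𝓝 0) := by
  let G := E.formSeminorm.toSeminormedAddCommGroup
  let M := G.toPseudoMetricSpace
  have h1 : E.formTopology (localMeasureUniformSpace m) =
      (⨅ U : {U : Set X // MeasurableSet U ∧ m U < ∞},
        (localPseudoMetric m U.1 U.2.2).toUniformSpace.toTopologicalSpace).induced Subtype.val ⊓
      M.toUniformSpace.toTopologicalSpace := by
    rw [← UniformSpace.toTopologicalSpace_iInf]
    rfl
  have h2 : @nhds _ (E.formTopology (localMeasureUniformSpace m)) g =
      Filter.comap Subtype.val (⨅ U : {U : Set X // MeasurableSet U ∧ m U < ∞},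
        @nhds _ (localPseudoMetric m U.1 U.2.2).toUniformSpace.toTopologicalSpace (g : X →ₘ[m] ℝ)) ⊓
      @nhds _ M.toUniformSpace.toTopologicalSpace g := by
    have hinf : ∀ t t₁ t₂ : TopologicalSpace E.domain, t = t₁ ⊓ t₂ →
        @nhds _ t g = @nhds _ t₁ g ⊓ @nhds _ t₂ g := by
      rintro _ t₁ t₂ rfl
      exact _root_.nhds_inf (t₁ := t₁) (t₂ := t₂)
    refine (hinf _ _ _ h1).trans ?_
    congr 1
    exact (@nhds_induced _ _ (_) _ g).trans (congrArg _ _root_.nhds_iInf)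
  rw [h2, tendsto_inf, tendsto_comap_iff, tendsto_iInf]
  refine and_congr ?_ ?_
  · constructor
    · intro h U hU hfin
      exact (@tendsto_iff_dist_tendsto_zero _ _ (localPseudoMetric m U hfin) _ _ _).1
        (h ⟨U, hU, hfin⟩)
    · rintro h ⟨U, hU, hfin⟩
      exact (@tendsto_iff_dist_tendsto_zero _ _ (localPseudoMetric m U hfin) _ _ _).2
        (h U hU hfin)
  · rw [tendsto_iff_norm_sub_tendsto_zero]
    rfl

/-- Completeness enters the proof here. Arbitrary filters are allowed, since the uniformity of local
convergence in measure need not be countably generated. -/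
theorem exists_tendsto_form_of_cauchy (hE : E.IsClosedForm (localMeasureUniformSpace m))
    {ι : Type*} {l : Filter ι} [l.NeBot] {u : ι → E.domain}
    (h1 : ∀ U, MeasurableSet U → m U < ∞ →
      Tendsto (fun p : ι × ι => locDist m U (u p.1) (u p.2)) (l ×ˢ l) (𝓝 0))
    (h2 : Tendsto (fun p : ι × ι => E.formSeminorm (u p.1 - u p.2)) (l ×ˢ l) (𝓝 0)) :
    ∃ g, Tendsto u l (@nhds _ (E.formTopology (localMeasureUniformSpace m)) g) := by
  have hne : Nonempty {U : Set X // MeasurableSet U ∧ m U < ∞} := ⟨∅, by simp⟩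
  have hc : @Cauchy _ (E.formUniformSpace (localMeasureUniformSpace m)) (map u l) := by
    rw [cauchy_inf_uniformSpace, cauchy_comap_uniformSpace, cauchy_iInf_uniformSpace]
    constructor
    · rintro ⟨U, hU, hfin⟩
      let := localPseudoMetric m U hfin
      rw [Filter.map_map, cauchy_map_iff]
      refine ⟨inferInstance, ?_⟩
      rw [Metric.uniformity_eq_comap_nhds_zero, tendsto_comap_iff]
      exact h1 U hU hfin
    · let := E.formSeminorm.toSeminormedAddCommGroup
      rw [cauchy_map_iff]
      refine ⟨inferInstance, ?_⟩
      rw [Metric.uniformity_eq_comap_nhds_zero, tendsto_comap_iff]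
      refine h2.congr fun p => ?_
      simp only [Function.comp, dist_eq_norm]
      rfl
  obtain ⟨g, hg⟩ := @CompleteSpace.complete _ (E.formUniformSpace (localMeasureUniformSpace m)) hE _ hc
  exact ⟨g, hg⟩

end LocDist

/-! ### Lower semicontinuity and strong approximation for closed forms -/

section LowerSemicontinuity

variable {X : Type*} [MeasurableSpace X] {m : Measure X} {E : QForm (X →ₘ[m] ℝ)}

/-- Lower semicontinuity of closed forms, together with strong approximation: a limit in measure
of elements of bounded energy from a midpoint-stable set `S` belongs to the closure of `S` in the
form topology. -/
theorem exists_mem_closure_of_locDist (hm : IsLocalizable m)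
    (hE : E.IsClosedForm (localMeasureUniformSpace m)) {S : Set (X →ₘ[m] ℝ)}
    (hSE : S ⊆ E.domain) (hS : ∀ u ∈ S, ∀ v ∈ S, (1 / 2 : ℝ) • (u + v) ∈ S)
    {g : X →ₘ[m] ℝ} {c : ℝ}
    (hg : ∀ U, MeasurableSet U → m U < ∞ → ∀ ε > 0,
      ∃ h ∈ S, (E h).toReal ≤ c ∧ locDist m U h g < ε) :
    ∃ hgE : g ∈ E.domain, (E g).toReal ≤ c ∧
      (⟨g, hgE⟩ : E.domain) ∈ @closure _ (E.formTopology (localMeasureUniformSpace m))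
        {f : E.domain | (f : X →ₘ[m] ℝ) ∈ S} := by
  let T := {U : Set X // MeasurableSet U ∧ m U < ∞}
  let ι := T × ℕ
  have hT : IsDirectedOrder T := ⟨fun U V =>
    ⟨⟨U.1 ∪ V.1, U.2.1.union V.2.1, (measure_union_le _ _).trans_lt
      (ENNReal.add_lt_top.2 ⟨U.2.2, V.2.2⟩)⟩, subset_union_left, subset_union_right⟩⟩
  have hTne : Nonempty T := ⟨⟨∅, by simp⟩⟩
  have hι : IsDirectedOrder ι := ⟨fun i j => by
    obtain ⟨U, h1, h2⟩ := hT.directed i.1 j.1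
    exact ⟨(U, max i.2 j.2), ⟨h1, le_max_left _ _⟩, ⟨h2, le_max_right _ _⟩⟩⟩
  have hιne : Nonempty ι := ⟨(hTne.some, 0)⟩
  -- For each (U, n), these are the energies available in `S` within 1/(n+1) of `g` for d_U. The net
  -- `h` chosen below consists of near-minimizers, with error 1/(n+1).
  let A : ι → Set ℝ := fun i => {r | ∃ h ∈ S, (E h).toReal = r ∧
    locDist m i.1.1 h g < 1 / ((i.2 : ℝ) + 1)}
  let φ : ι → ℝ := fun i => sInf (A i)
  have hbdd : ∀ i, BddBelow (A i) := fun i => ⟨0, by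
    rintro _ ⟨h, -, rfl, -⟩; exact ENNReal.toReal_nonneg⟩
  have hAc : ∀ i, ∃ r ∈ A i, r ≤ c := by
    intro i
    obtain ⟨h, hh, hc, hd⟩ := hg i.1.1 i.1.2.1 i.1.2.2 (1 / ((i.2 : ℝ) + 1)) (by positivity)
    exact ⟨_, ⟨h, hh, rfl, hd⟩, hc⟩
  have hφc : ∀ i, φ i ≤ c := fun i => by
    obtain ⟨r, hr, hrc⟩ := hAc i
    exact (csInf_le (hbdd i) hr).trans hrc
  have hrange : BddAbove (range φ) := ⟨c, by rintro _ ⟨i, rfl⟩; exact hφc i⟩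
  have hex : ∀ i : ι, ∃ h ∈ S, (E h).toReal < φ i + 1 / ((i.2 : ℝ) + 1) ∧
      locDist m i.1.1 h g < 1 / ((i.2 : ℝ) + 1) := by
    intro i
    obtain ⟨r0, hr0, -⟩ := hAc i
    obtain ⟨_, ⟨h, hh, rfl, hd⟩, hlt⟩ := exists_lt_of_csInf_lt ⟨r0, hr0⟩
      (lt_add_of_pos_right (sInf (A i)) (show (0 : ℝ) < 1 / ((i.2 : ℝ) + 1) by positivity))
    exact ⟨h, hh, hlt, hd⟩
  choose h hhS hhE hhd using hex
  have hhD : ∀ i, h i ∈ E.domain := fun i => hSE (hhS i)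
  let u : ι → E.domain := fun i => ⟨h i, hhD i⟩
  have hone : Tendsto (fun i : ι => 1 / ((i.2 : ℝ) + 1)) atTop (𝓝 0) := by
    have : Tendsto (fun i : ι => i.2) atTop atTop := tendsto_snd.comp
      (prod_atTop_atTop_eq (α := T) (β := ℕ)).ge
    exact tendsto_one_div_add_atTop_nhds_zero_nat.comp this
  -- The net converges to `g` locally in measure.
  have hlim : ∀ U, MeasurableSet U → m U < ∞ →
      Tendsto (fun i => locDist m U (h i) g) atTop (𝓝 0) := by
    intro U hU hfin
    refine tendsto_of_tendsto_of_tendsto_of_le_of_le' tendsto_const_nhds hone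
      (Eventually.of_forall fun i => locDist_nonneg _ _ _) ?_
    filter_upwards [eventually_ge_atTop ((⟨U, hU, hfin⟩, 0) : ι)] with i hi
    exact (locDist_mono_set i.1.2.2 hi.1 _ _).trans (hhd i).le
  -- The net is Cauchy for the form seminorm.
  have hcauchy : Tendsto (fun p : ι × ι => E.formSeminorm (u p.1 - u p.2))
      (atTop ×ˢ atTop) (𝓝 0) := by
    have hsq : ∀ δ > 0, ∃ k : ι, ∀ i ≥ k, ∀ j ≥ k, (E (h i - h j)).toReal ≤ 8 * δ := by
      intro δ hδ
      obtain ⟨_, ⟨k, rfl⟩, hk⟩ := exists_lt_of_lt_csSup (range_nonempty φ)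
        (show sSup (range φ) - δ < sSup (range φ) by linarith)
      obtain ⟨N, hN⟩ := exists_nat_one_div_lt hδ
      -- The index 2k+1 halves the tolerance 1/(k+1), so that midpoints of later elements still
      -- compete at `k`; `N` brings the minimization error below δ.
      refine ⟨(k.1, max (2 * k.2 + 1) N), fun i hi j hj => ?_⟩
      have hsmall : ∀ i : ι, ((k.1, max (2 * k.2 + 1) N) : ι) ≤ i →
          1 / ((i.2 : ℝ) + 1) < δ ∧ 1 / ((i.2 : ℝ) + 1) ≤ 1 / 2 * (1 / ((k.2 : ℝ) + 1)) := by
        intro i hi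
        have h1 : 2 * k.2 + 1 ≤ i.2 := (le_max_left _ _).trans hi.2
        have h2 : N ≤ i.2 := (le_max_right _ _).trans hi.2
        constructor
        · refine lt_of_le_of_lt ?_ hN
          gcongr
        · rw [div_mul_div_comm, one_mul]
          have : (2 * k.2 + 1 : ℝ) ≤ i.2 := by exact_mod_cast h1
          exact one_div_le_one_div_of_le (by positivity) (by linarith)
      obtain ⟨hi1, hi2⟩ := hsmall i hi
      obtain ⟨hj1, hj2⟩ := hsmall j hj
      -- Both energies are below sup φ + δ and the midpoint has energy above sup φ − δ, so the
      -- parallelogram identity leaves at most 8δ for the difference.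
      have hmid : φ k ≤ (E ((1 / 2 : ℝ) • (h i + h j))).toReal := by
        refine csInf_le (hbdd k) ⟨_, hS _ (hhS i) _ (hhS j), rfl, ?_⟩
        have h1 := locDist_mono_set i.1.2.2 hi.1 (h i) g
        have h2 := locDist_mono_set j.1.2.2 hj.1 (h j) g
        have h3 := locDist_midpoint k.1.2.2 (h i) (h j) g
        have h4 := hhd i
        have h5 := hhd j
        simp only at h1 h2
        linarith
      rw [E.toReal_smul] at hmid
      have h1 := E.toReal_parallelogram (hhD i) (hhD j)
      have h2 := hhE i
      have h3 := hhE j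
      have h4 := le_csSup hrange ⟨i, rfl⟩
      have h5 := le_csSup hrange ⟨j, rfl⟩
      linarith
    rw [prod_atTop_atTop_eq, Metric.tendsto_nhds]
    intro ε hε
    obtain ⟨k, hk⟩ := hsq (ε ^ 2 / 16) (by positivity)
    filter_upwards [eventually_ge_atTop (k, k)] with p hp
    rw [Real.dist_0_eq_abs, abs_of_nonneg (apply_nonneg _ _)]
    refine lt_of_pow_lt_pow_left₀ 2 hε.le ?_
    rw [E.formSeminorm_sq]
    have := hk p.1 hp.1 p.2 hp.2
    have h2 : 0 < ε ^ 2 := by positivity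
    calc _ ≤ 8 * (ε ^ 2 / 16) := this
      _ < ε ^ 2 := by linarith
  obtain ⟨f, hf⟩ := exists_tendsto_form_of_cauchy hE (l := (atTop : Filter ι)) (u := u) (by
      intro U hU hfin
      have h0 := hlim U hU hfin
      have h1 := (h0.comp tendsto_fst).add (h0.comp (tendsto_snd (f := (atTop : Filter ι))))
      rw [add_zero] at h1
      refine squeeze_zero (fun _ => locDist_nonneg _ _ _) (fun p => ?_) h1
      refine (locDist_triangle hfin (h p.1) g (h p.2)).trans_eq ?_
      rw [locDist_comm U g]; rfl) hcauchy
  have hf' := tendsto_form_iff.1 hf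
  have hfg : (f : X →ₘ[m] ℝ) = g := by
    refine eq_of_locDist_eq_zero hm fun U hU hfin => ?_
    have h1 := (hf'.1 U hU hfin).add (hlim U hU hfin)
    rw [add_zero] at h1
    refine le_antisymm (ge_of_tendsto' h1 fun i => ?_) (locDist_nonneg _ _ _)
    rw [locDist_comm U (u i : X →ₘ[m] ℝ)]
    exact locDist_triangle hfin _ (h i) g
  subst hfg
  refine ⟨f.2, ?_, by
    let _ := E.formTopology (localMeasureUniformSpace m)
    exact mem_closure_of_tendsto hf (Eventually.of_forall hhS)⟩
  have hc0 : 0 ≤ c := by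
    obtain ⟨r, ⟨h, -, rfl, -⟩, hr⟩ := hAc hιne.some
    exact ENNReal.toReal_nonneg.trans hr
  rw [← E.formSeminorm_sq, ← Real.le_sqrt (apply_nonneg _ _) hc0]
  have h1 : Tendsto (fun i : ι => √(c + 1 / ((i.2 : ℝ) + 1)) + E.formSeminorm (u i - f))
      atTop (𝓝 (√(c + 0) + 0)) := ((hone.const_add c).sqrt).add hf'.2
  rw [add_zero, add_zero] at h1
  refine ge_of_tendsto' h1 fun i => ?_
  have h2 : E.formSeminorm f ≤ E.formSeminorm (u i) + E.formSeminorm (u i - f) := by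
    have := map_sub_le_add E.formSeminorm (u i) (u i - f)
    rwa [sub_sub_cancel] at this
  have h3 : E.formSeminorm (u i) ≤ √(c + 1 / ((i.2 : ℝ) + 1)) :=
    Real.sqrt_le_sqrt ((hhE i).le.trans (by simpa using hφc i))
  linarith

/-- Almost everywhere limits of sequences of bounded energy. -/
theorem exists_mem_closure_of_ae_tendsto (hm : IsLocalizable m)
    (hE : E.IsClosedForm (localMeasureUniformSpace m)) {S : Set (X →ₘ[m] ℝ)}
    (hSE : S ⊆ E.domain) (hS : ∀ u ∈ S, ∀ v ∈ S, (1 / 2 : ℝ) • (u + v) ∈ S)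
    {f : ℕ → X →ₘ[m] ℝ} {g : X →ₘ[m] ℝ} {c : ℝ} (hf : ∀ n, f n ∈ S)
    (hc : ∀ n, (E (f n)).toReal ≤ c)
    (hfg : ∀ᵐ x ∂m, Tendsto (fun n => f n x) atTop (𝓝 (g x))) :
    ∃ hgE : g ∈ E.domain, (E g).toReal ≤ c ∧
      (⟨g, hgE⟩ : E.domain) ∈ @closure _ (E.formTopology (localMeasureUniformSpace m))
        {f : E.domain | (f : X →ₘ[m] ℝ) ∈ S} := by
  refine exists_mem_closure_of_locDist hm hE hSE hS fun U hU hfin ε hε => ?_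
  obtain ⟨n, hn⟩ := ((tendsto_locDist_of_ae hfin hfg).eventually_lt_const hε).exists
  exact ⟨f n, hf n, hc n, hn⟩

theorem midpoint_mem {V : Type*} [AddCommGroup V] [Module ℝ V] (W : Submodule ℝ V) :
    ∀ u ∈ W, ∀ v ∈ W, (1 / 2 : ℝ) • (u + v) ∈ W :=
  fun _ hu _ hv => W.smul_mem _ (W.add_mem hu hv)

/-- Fatou-type principle: the case `S = D(E)` of the approximation result. -/
theorem mem_domain_of_ae_tendsto (hm : IsLocalizable m)
    (hE : E.IsClosedForm (localMeasureUniformSpace m))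
    {f : ℕ → X →ₘ[m] ℝ} {g : X →ₘ[m] ℝ} {c : ℝ} (hf : ∀ n, f n ∈ E.domain)
    (hc : ∀ n, (E (f n)).toReal ≤ c)
    (hfg : ∀ᵐ x ∂m, Tendsto (fun n => f n x) atTop (𝓝 (g x))) :
    g ∈ E.domain ∧ (E g).toReal ≤ c := by
  obtain ⟨h, h1, -⟩ := exists_mem_closure_of_ae_tendsto hm hE subset_rfl
    (midpoint_mem E.domain) hf hc hfg
  exact ⟨h, h1⟩

/-- Needed where approximants come from density of a nest, hence for one U and ε at a time rather
than as a sequence. -/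
theorem mem_domain_of_locDist (hm : IsLocalizable m)
    (hE : E.IsClosedForm (localMeasureUniformSpace m)) {g : X →ₘ[m] ℝ} {c : ℝ}
    (hg : ∀ U, MeasurableSet U → m U < ∞ → ∀ ε > 0,
      ∃ h ∈ E.domain, (E h).toReal ≤ c ∧ locDist m U h g < ε) :
    g ∈ E.domain := by
  obtain ⟨h, -, -⟩ := exists_mem_closure_of_locDist hm hE subset_rfl
    (midpoint_mem E.domain) hg
  exact h

/-- Elements of the form closure are approximated locally in measure with bounded energy. -/
theorem exists_approx_of_mem_closure {S : Set (X →ₘ[m] ℝ)} {f : E.domain}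
    (hf : f ∈ @closure _ (E.formTopology (localMeasureUniformSpace m))
      {f : E.domain | (f : X →ₘ[m] ℝ) ∈ S})
    {U : Set X} (hU : MeasurableSet U) (hfin : m U < ∞) {ε : ℝ} (hε : 0 < ε) :
    ∃ h : E.domain, (h : X →ₘ[m] ℝ) ∈ S ∧ locDist m U h f < ε ∧
      (E ((h : X →ₘ[m] ℝ) - f)).toReal < 1 := by
  have h1 := tendsto_form_iff.1 (@tendsto_id _ (@nhds _ (E.formTopology
    (localMeasureUniformSpace m)) f))
  have h2 := ((h1.1 U hU hfin).eventually_lt_const hε).and (h1.2.eventually_lt_const one_pos)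
  obtain ⟨h, ⟨h3, h4⟩, h5⟩ := (@mem_closure_iff_nhds _ (_) _ _).1 hf _ h2
  refine ⟨h, h5, h3, ?_⟩
  have h6 := E.formSeminorm_sq (h - f)
  rw [Submodule.coe_sub] at h6
  rw [← h6]
  exact pow_lt_one₀ (apply_nonneg _ _) h4 two_ne_zero

end LowerSemicontinuity

/-! ### Truncations and lattice operations from the Markov property -/

section Markov

variable {X : Type*} [MeasurableSpace X] {m : Measure X} {E : QForm (X →ₘ[m] ℝ)}

theorem IsCutoff.abs_sub_clamp_le {ε : ℝ} {C : ℝ → ℝ} (hC : IsCutoff ε C) (t : ℝ) :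
    |C t - min (max t 0) 1| ≤ ε := by
  have h0 := hC.mem_Icc t
  have hε : 0 ≤ ε := by
    have := hC.mem_Icc 0
    rw [hC.map_zero] at this
    linarith [this.1]
  rcases le_total t 0 with ht | ht
  · have h1 := hC.monotone ht
    rw [hC.map_zero] at h1
    rw [max_eq_right ht, min_eq_left zero_le_one, abs_le]
    constructor <;> linarith [h0.1]
  · rw [max_eq_left ht]
    rcases le_total t 1 with ht1 | ht1
    · rw [min_eq_left ht1, hC.eq_self t ⟨ht, ht1⟩, sub_self, abs_zero]
      exact hε
    · have h1 := hC.monotone ht1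
      rw [hC.eq_self 1 ⟨zero_le_one, le_rfl⟩] at h1
      rw [min_eq_right ht1, abs_le]
      constructor <;> linarith [h0.2]

theorem ae_coeFn_zero : ∀ᵐ x ∂m, (0 : X →ₘ[m] ℝ) x = 0 := AEEqFun.coeFn_zero

theorem ae_coeFn_const (a : ℝ) : ∀ᵐ x ∂m, (AEEqFun.const X a : X →ₘ[m] ℝ) x = a :=
  AEEqFun.coeFn_const X a

theorem ae_coeFn_posPart (f : X →ₘ[m] ℝ) : ∀ᵐ x ∂m, (f ⊔ 0) x = max (f x) 0 := by
  filter_upwards [AEEqFun.coeFn_sup f 0, ae_coeFn_zero (m := m)] with x h1 h2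
  rw [h1, h2]

theorem ae_coeFn_clamp (f : X →ₘ[m] ℝ) (a : ℝ) :
    ∀ᵐ x ∂m, ((f ⊔ 0) ⊓ AEEqFun.const X a) x = min (max (f x) 0) a := by
  filter_upwards [AEEqFun.coeFn_inf (f ⊔ 0) (AEEqFun.const X a), ae_coeFn_posPart f,
    ae_coeFn_const (m := m) a] with x h1 h2 h3
  rw [h1, h2, h3]

variable (hm : IsLocalizable m) (hE : IsEnergyForm E)
include hm hE

/-- By monotonicity and its range, an ε-cutoff is uniformly ε-close to the clamp onto [0, 1].
Letting ε = 1/(n+1) → 0, lower semicontinuity transfers the energy bound to the clamp itself. -/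
theorem IsEnergyForm.unit_clamp {f : X →ₘ[m] ℝ} (hf : f ∈ E.domain) :
    (f ⊔ 0) ⊓ AEEqFun.const X 1 ∈ E.domain ∧
      (E ((f ⊔ 0) ⊓ AEEqFun.const X 1)).toReal ≤ (E f).toReal := by
  choose C hC hCE using fun n : ℕ => hE.markovian (1 / ((n : ℝ) + 1)) (by positivity)
  refine mem_domain_of_ae_tendsto hm hE.closed (f := fun n => f.comp (C n) (hC n).continuous)
    (fun n => (hCE n f).trans_lt hf) (fun n => ENNReal.toReal_mono (ne_of_lt hf) (hCE n f)) ?_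
  filter_upwards [ae_coeFn_clamp f 1,
    ae_all_iff.2 fun n => AEEqFun.coeFn_comp (C n) (hC n).continuous f] with x h1 h2
  rw [tendsto_iff_dist_tendsto_zero]
  refine squeeze_zero (fun _ => dist_nonneg) (fun n => ?_)
    (tendsto_one_div_add_atTop_nhds_zero_nat (𝕜 := ℝ))
  rw [h1, h2, Real.dist_eq]
  exact (hC n).abs_sub_clamp_le (f x)

theorem IsEnergyForm.clamp {f : X →ₘ[m] ℝ} (hf : f ∈ E.domain) {a : ℝ} (ha : 0 ≤ a) :
    (f ⊔ 0) ⊓ AEEqFun.const X a ∈ E.domain ∧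
      (E ((f ⊔ 0) ⊓ AEEqFun.const X a)).toReal ≤ (E f).toReal := by
  rcases ha.eq_or_lt with rfl | ha
  · have : (f ⊔ 0) ⊓ AEEqFun.const X 0 = (0 : X →ₘ[m] ℝ) := by
      refine AEEqFun.ext ?_
      filter_upwards [ae_coeFn_clamp f 0, ae_coeFn_zero (m := m)] with x h1 h2
      rw [h1, h2, min_eq_right (le_max_right _ _)]
    rw [this]
    have h0 := E.toReal_smul 0 0
    rw [smul_zero] at h0
    refine ⟨E.domain.zero_mem, ?_⟩
    rw [h0]
    simp
  · have h1 := hE.unit_clamp hm (E.domain.smul_mem a⁻¹ hf)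
    have : (f ⊔ 0) ⊓ AEEqFun.const X a = a • ((a⁻¹ • f ⊔ 0) ⊓ AEEqFun.const X 1) := by
      refine AEEqFun.ext ?_
      filter_upwards [ae_coeFn_clamp f a, ae_coeFn_clamp (a⁻¹ • f) 1,
        AEEqFun.coeFn_smul a⁻¹ f,
        AEEqFun.coeFn_smul a ((a⁻¹ • f ⊔ 0) ⊓ AEEqFun.const X 1)] with x h1 h2 h3 h4
      rw [h1, h4, Pi.smul_apply, h2, h3, Pi.smul_apply, smul_eq_mul, smul_eq_mul,
        mul_min_of_nonneg _ _ ha.le, mul_max_of_nonneg _ _ ha.le, mul_inv_cancel_left₀ ha.ne',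
        mul_zero, mul_one]
    rw [this]
    refine ⟨E.domain.smul_mem _ h1.1, ?_⟩
    rw [E.toReal_smul]
    have h2 := h1.2
    rw [E.toReal_smul] at h2
    calc _ ≤ a ^ 2 * (a⁻¹ ^ 2 * (E f).toReal) := by gcongr
      _ = (E f).toReal := by field_simp

theorem IsEnergyForm.posPart {f : X →ₘ[m] ℝ} (hf : f ∈ E.domain) :
    f ⊔ 0 ∈ E.domain ∧ (E (f ⊔ 0)).toReal ≤ (E f).toReal := by
  refine mem_domain_of_ae_tendsto hm hE.closed
    (f := fun n : ℕ => (f ⊔ 0) ⊓ AEEqFun.const X (n : ℝ))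
    (fun n => (hE.clamp hm hf n.cast_nonneg).1) (fun n => (hE.clamp hm hf n.cast_nonneg).2) ?_
  filter_upwards [ae_coeFn_posPart f, ae_all_iff.2 fun n : ℕ => ae_coeFn_clamp f (n : ℝ)]
    with x h1 h2
  refine tendsto_const_nhds.congr' ?_
  obtain ⟨N, hN⟩ := exists_nat_ge (max (f x) 0)
  filter_upwards [eventually_ge_atTop N] with n hn
  rw [h1, h2, min_eq_left (hN.trans (by exact_mod_cast hn))]

/-- This is (f − a)⁺, written as a difference of two elements of D(E) because constants need not
belong to D(E). The bound does not depend on `a`. -/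
theorem IsEnergyForm.excess {f : X →ₘ[m] ℝ} (hf : f ∈ E.domain) {a : ℝ} (ha : 0 ≤ a) :
    (f ⊔ 0) - (f ⊔ 0) ⊓ AEEqFun.const X a ∈ E.domain ∧
      (E ((f ⊔ 0) - (f ⊔ 0) ⊓ AEEqFun.const X a)).toReal ≤ 4 * (E f).toReal := by
  obtain ⟨h1, h2⟩ := hE.posPart hm hf
  obtain ⟨h3, h4⟩ := hE.clamp hm hf ha
  exact ⟨E.domain.sub_mem h1 h3, (E.toReal_sub_le h1 h3).trans (by linarith)⟩

omit hm hE in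
theorem ae_coeFn_excess (f : X →ₘ[m] ℝ) {a : ℝ} (ha : 0 ≤ a) :
    ∀ᵐ x ∂m, ((f ⊔ 0) - (f ⊔ 0) ⊓ AEEqFun.const X a) x = max (f x - a) 0 := by
  filter_upwards [AEEqFun.coeFn_sub (f ⊔ 0) ((f ⊔ 0) ⊓ AEEqFun.const X a), ae_coeFn_posPart f,
    ae_coeFn_clamp f a] with x h1 h2 h3
  rw [h1, Pi.sub_apply, h2, h3]
  grind

theorem IsEnergyForm.inf {f g : X →ₘ[m] ℝ} (hf : f ∈ E.domain) (hg : g ∈ E.domain) :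
    f ⊓ g ∈ E.domain ∧ (E (f ⊓ g)).toReal ≤ 6 * (E f).toReal + 4 * (E g).toReal := by
  -- The constants 6 and 4 come from applying E(u − v) ≤ 2E(u) + 2E(v) twice.
  have h : f ⊓ g = f - ((f - g) ⊔ 0) := by
    refine AEEqFun.ext ?_
    filter_upwards [AEEqFun.coeFn_inf f g, AEEqFun.coeFn_sub f ((f - g) ⊔ 0),
      ae_coeFn_posPart (f - g), AEEqFun.coeFn_sub f g] with x h1 h2 h3 h4
    rw [h1, h2, Pi.sub_apply, h3, h4, Pi.sub_apply]
    grind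
  obtain ⟨h1, h2⟩ := hE.posPart hm (E.domain.sub_mem hf hg)
  rw [h]
  refine ⟨E.domain.sub_mem hf h1, ?_⟩
  have h3 := E.toReal_sub_le hf h1
  have h4 := E.toReal_sub_le hf hg
  linarith

theorem IsEnergyForm.abs {f : X →ₘ[m] ℝ} (hf : f ∈ E.domain) : |f| ∈ E.domain := by
  have h : |f| = (f ⊔ 0) + (-f ⊔ 0) := by
    refine AEEqFun.ext ?_
    filter_upwards [AEEqFun.coeFn_abs f, AEEqFun.coeFn_add (f ⊔ 0) (-f ⊔ 0),
      ae_coeFn_posPart f, ae_coeFn_posPart (-f), AEEqFun.coeFn_neg f] with x h1 h2 h3 h4 h5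
    rw [h1, h2, Pi.add_apply, h3, h4, h5, Pi.neg_apply]
    grind
  rw [h]
  exact E.domain.add_mem (hE.posPart hm hf).1 (hE.posPart hm (E.domain.neg_mem hf)).1

/-! ### Products of bounded elements -/

omit hm hE in
/-- The layer sums `∑ (t - j)⁺` approximate `t² / 2`. -/
theorem sum_layers_mem_Icc (n : ℕ) :
    ∀ t : ℝ, 0 ≤ t → t ≤ n →
      ∑ j ∈ Finset.range n, max (t - j) 0 ∈ Icc (t ^ 2 / 2) (t ^ 2 / 2 + t) := by
  induction n with
  | zero =>
    intro t h0 h1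
    have : t = 0 := le_antisymm (by simpa using h1) h0
    simp [this]
  | succ n ih =>
    intro t h0 h1
    -- The layer j = 0 contributes `t`; the others are the layers of t − 1.
    rw [Finset.sum_range_succ']
    have hs : ∑ j ∈ Finset.range n, max (t - ((j + 1 : ℕ) : ℝ)) 0 =
        ∑ j ∈ Finset.range n, max (t - 1 - j) 0 :=
      Finset.sum_congr rfl fun j _ => by push_cast; congr 1; ring
    rw [hs, Nat.cast_zero, sub_zero, max_eq_left h0]
    rcases le_total 1 t with h | h
    · obtain ⟨h2, h3⟩ := ih (t - 1) (by linarith) (by push_cast at h1; linarith)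
      constructor <;> nlinarith
    · have h4 : ∑ j ∈ Finset.range n, max (t - 1 - (j : ℝ)) 0 = 0 :=
        Finset.sum_eq_zero fun j _ => max_eq_right (by
          have : (0 : ℝ) ≤ j := j.cast_nonneg
          linarith)
      rw [h4]
      constructor <;> nlinarith

omit hm hE in
-- These are Riemann sums of ∫₀¹ (t − s)⁺ ds = t²/2. Rescaling by N reduces to integer layers, with
-- error at most 1/N.
theorem tendsto_average_layers {t : ℝ} (h0 : 0 ≤ t) (h1 : t ≤ 1) :
    Tendsto (fun n : ℕ => ((n + 1 : ℕ) : ℝ)⁻¹ *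
      ∑ j ∈ Finset.range (n + 1), max (t - j / ((n + 1 : ℕ) : ℝ)) 0) atTop (𝓝 (t ^ 2 / 2)) := by
  rw [tendsto_iff_dist_tendsto_zero]
  refine squeeze_zero (fun _ => dist_nonneg) (fun n => ?_)
    (tendsto_one_div_add_atTop_nhds_zero_nat (𝕜 := ℝ))
  set N : ℝ := ((n + 1 : ℕ) : ℝ) with hN
  have hN0 : 0 < N := by positivity
  have hN1 : (n : ℝ) + 1 = N := by rw [hN]; push_cast; rfl
  rw [hN1]
  have hs : ∑ j ∈ Finset.range (n + 1), max (t - j / N) 0 =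
      N⁻¹ * ∑ j ∈ Finset.range (n + 1), max (N * t - j) 0 := by
    rw [Finset.mul_sum]
    refine Finset.sum_congr rfl fun j _ => ?_
    rw [mul_max_of_nonneg _ _ (by positivity), mul_zero]
    congr 1
    field_simp
  obtain ⟨h2, h3⟩ := sum_layers_mem_Icc (n + 1) (N * t) (by positivity)
    (by rw [← hN]; nlinarith)
  rw [hs, Real.dist_eq, abs_le]
  generalize ∑ j ∈ Finset.range (n + 1), max (N * t - j) 0 = S at *
  have h4 : N⁻¹ * (N⁻¹ * S) - t ^ 2 / 2 = (N⁻¹) ^ 2 * (S - (N * t) ^ 2 / 2) := by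
    field_simp
  rw [h4]
  constructor
  · have : 0 ≤ (N⁻¹) ^ 2 * (S - (N * t) ^ 2 / 2) := mul_nonneg (by positivity) (by linarith)
    have : 0 ≤ 1 / N := by positivity
    linarith
  · calc (N⁻¹) ^ 2 * (S - (N * t) ^ 2 / 2) ≤ (N⁻¹) ^ 2 * (N * 1) := by
          gcongr
          nlinarith
      _ = 1 / N := by field_simp

/-- f²/2 is a limit of averages of the functions (f − s)⁺, all of energy at most 4E(f). Averaging
preserves this bound, so lower semicontinuity applies. -/
theorem IsEnergyForm.mul_self_of_mem_Icc {f : X →ₘ[m] ℝ} (hf : f ∈ E.domain)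
    (h01 : ∀ᵐ x ∂m, f x ∈ Icc (0 : ℝ) 1) : f * f ∈ E.domain := by
  let F : ℕ → ℕ → X →ₘ[m] ℝ := fun n j =>
    (f ⊔ 0) - (f ⊔ 0) ⊓ AEEqFun.const X ((j : ℝ) / ((n + 1 : ℕ) : ℝ))
  have hF : ∀ n j, F n j ∈ E.domain ∧ (E (F n j)).toReal ≤ 4 * (E f).toReal :=
    fun n j => hE.excess hm hf (by positivity)
  have key := mem_domain_of_ae_tendsto hm hE.closed (g := (1 / 2 : ℝ) • (f * f))
    (f := fun n => ((n + 1 : ℕ) : ℝ)⁻¹ • ∑ j ∈ Finset.range (n + 1), F n j)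
    (c := 4 * (E f).toReal)
    (fun n => E.domain.smul_mem _ (E.domain.sum_mem fun j _ => (hF n j).1))
    (fun n => E.toReal_average_le n.succ_pos (fun j => (hF n j).1) (fun j => (hF n j).2)) ?_
  · have := E.domain.smul_mem 2 key.1
    rwa [smul_smul, show (2 : ℝ) * (1 / 2) = 1 by norm_num, one_smul] at this
  · filter_upwards [h01, AEEqFun.coeFn_smul (1 / 2 : ℝ) (f * f), AEEqFun.coeFn_mul f f,
      ae_all_iff.2 fun n : ℕ => AEEqFun.coeFn_smul (((n + 1 : ℕ) : ℝ)⁻¹)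
        (∑ j ∈ Finset.range (n + 1), F n j),
      ae_all_iff.2 fun n : ℕ => AEEqFun.coeFn_fun_finsetSum (Finset.range (n + 1)) (F n),
      ae_all_iff.2 fun n : ℕ => ae_all_iff.2 fun j : ℕ =>
        ae_coeFn_excess f (a := (j : ℝ) / ((n + 1 : ℕ) : ℝ)) (by positivity)]
      with x h1 h2 h3 h4 h5 h6
    rw [h2, Pi.smul_apply, h3, Pi.mul_apply, smul_eq_mul,
      show 1 / 2 * (f x * f x) = f x ^ 2 / 2 by ring]
    refine (tendsto_average_layers h1.1 h1.2).congr fun n => ?_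
    rw [h4, Pi.smul_apply, h5, smul_eq_mul]
    simp only [F, h6]

theorem IsEnergyForm.mul_self {f : X →ₘ[m] ℝ} (hf : f ∈ E.domain) {K : ℝ}
    (hK : ∀ᵐ x ∂m, |f x| ≤ K) : f * f ∈ E.domain := by
  have hL : (0 : ℝ) < |K| + 1 := by positivity
  set L := |K| + 1
  have h1 := hE.mul_self_of_mem_Icc hm (E.domain.smul_mem L⁻¹ (hE.abs hm hf)) (by
    filter_upwards [hK, AEEqFun.coeFn_smul L⁻¹ |f|, AEEqFun.coeFn_abs f] with x h1 h2 h3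
    rw [h2, Pi.smul_apply, h3, smul_eq_mul]
    refine ⟨by positivity, ?_⟩
    rw [inv_mul_le_iff₀ hL]
    linarith [le_abs_self K])
  have h2 := E.domain.smul_mem (L ^ 2) h1
  convert h2 using 1
  refine AEEqFun.ext ?_
  filter_upwards [AEEqFun.coeFn_smul L⁻¹ |f|, AEEqFun.coeFn_abs f, AEEqFun.coeFn_mul f f,
    AEEqFun.coeFn_mul (L⁻¹ • |f|) (L⁻¹ • |f|),
    AEEqFun.coeFn_smul (L ^ 2) (L⁻¹ • |f| * L⁻¹ • |f|)] with x h1 h2 h3 h4 h5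
  rw [h3, h5, Pi.smul_apply, h4, Pi.mul_apply, Pi.mul_apply, h1, Pi.smul_apply, h2, smul_eq_mul,
    smul_eq_mul, ← abs_mul_abs_self (f x)]
  field_simp

theorem IsEnergyForm.mul {f g : X →ₘ[m] ℝ} (hf : f ∈ E.domain) (hg : g ∈ E.domain) {K L : ℝ}
    (hK : ∀ᵐ x ∂m, |f x| ≤ K) (hL : ∀ᵐ x ∂m, |g x| ≤ L) : f * g ∈ E.domain := by
  have h1 := hE.mul_self hm (E.domain.add_mem hf hg) (K := K + L) (by
    filter_upwards [hK, hL, AEEqFun.coeFn_add f g] with x h1 h2 h3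
    rw [h3]
    exact (abs_add_le _ _).trans (add_le_add h1 h2))
  have h2 := hE.mul_self hm (E.domain.sub_mem hf hg) (K := K + L) (by
    filter_upwards [hK, hL, AEEqFun.coeFn_sub f g] with x h1 h2 h3
    rw [h3]
    exact (abs_sub _ _).trans (add_le_add h1 h2))
  have h3 := E.domain.smul_mem (1 / 4) (E.domain.sub_mem h1 h2)
  -- Polarization reduces products to squares.
  have h4 : (f + g) * (f + g) - (f - g) * (f - g) = (4 : ℝ) • (f * g) := by
    refine AEEqFun.ext ?_
    filter_upwards [AEEqFun.coeFn_add f g, AEEqFun.coeFn_sub f g, AEEqFun.coeFn_mul f g,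
      AEEqFun.coeFn_mul (f + g) (f + g), AEEqFun.coeFn_mul (f - g) (f - g),
      AEEqFun.coeFn_smul (4 : ℝ) (f * g),
      AEEqFun.coeFn_sub ((f + g) * (f + g)) ((f - g) * (f - g))] with x h1 h2 h3 h4 h5 h6 h7
    simp only [h7, h6, h5, h4, h3, h2, h1, Pi.add_apply, Pi.sub_apply, Pi.mul_apply,
      Pi.smul_apply, smul_eq_mul]
    ring
  rwa [h4, smul_smul, show (1 / 4 : ℝ) * 4 = 1 by norm_num, one_smul] at h3

omit hm hE in
theorem mem_essBounded_iff {f : X →ₘ[m] ℝ} :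
    f ∈ essBounded m ↔ ∃ K : ℝ, ∀ᵐ x ∂m, |f x| ≤ K := by
  constructor
  · intro h
    have h1 := (Lp.mem_Lp_iff_memLp.1 h).2
    rw [eLpNorm_exponent_top] at h1
    refine ⟨(eLpNormEssSup f m).toReal, ?_⟩
    filter_upwards [ae_le_eLpNormEssSup (f := f) (μ := m)] with x hx
    have h2 := ENNReal.toReal_mono h1.ne hx
    rwa [toReal_enorm, Real.norm_eq_abs] at h2
  · rintro ⟨K, hK⟩
    exact Lp.mem_Lp_iff_memLp.2 (memLp_top_of_bound f.aestronglyMeasurable K hK)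

end Markov

/-! ### Construction of nests and the domination argument -/

section Nests

variable {X : Type*} [MeasurableSpace X] {m : Measure X} {E E' : QForm (X →ₘ[m] ℝ)}

/-- The sets on which some element of `D(E)` is at least `1` and `f` is essentially bounded. -/
def boundedNest (E : QForm (X →ₘ[m] ℝ)) (f : X →ₘ[m] ℝ) : Set (Set X) :=
  {N | MeasurableSet N ∧ (∃ g ∈ E.domain, ∀ᵐ x ∂m, N.indicator (fun _ => (1 : ℝ)) x ≤ g x) ∧
    ∃ K : ℝ, ∀ᵐ x ∂m, x ∈ N → |f x| ≤ K}

variable (hm : IsLocalizable m) (hE : IsEnergyForm E)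
include hm hE

theorem union_mem_boundedNest {f : X →ₘ[m] ℝ} {M N : Set X} (hM : M ∈ boundedNest E f)
    (hN : N ∈ boundedNest E f) : M ∪ N ∈ boundedNest E f := by
  obtain ⟨hM1, ⟨g, hg, hMg⟩, K, hK⟩ := hM
  obtain ⟨hN1, ⟨h, hh, hNh⟩, L, hL⟩ := hN
  refine ⟨hM1.union hN1, ⟨(g ⊔ 0) + (h ⊔ 0), E.domain.add_mem (hE.posPart hm hg).1
    (hE.posPart hm hh).1, ?_⟩, max K L, ?_⟩
  · filter_upwards [hMg, hNh, AEEqFun.coeFn_add (g ⊔ 0) (h ⊔ 0), ae_coeFn_posPart g,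
      ae_coeFn_posPart h] with x h1 h2 h3 h4 h5
    rw [h3, Pi.add_apply, h4, h5]
    simp only [indicator] at *
    grind
  · filter_upwards [hK, hL] with x h1 h2 hx
    rcases hx with hx | hx
    · exact (h1 hx).trans (le_max_left _ _)
    · exact (h2 hx).trans (le_max_right _ _)

/-- `D(E)_𝒩` as a subspace, for the nest `boundedNest E f`. -/
theorem exists_submodule_boundedNest (f : X →ₘ[m] ℝ) :
    ∃ W : Submodule ℝ (X →ₘ[m] ℝ), (W : Set (X →ₘ[m] ℝ)) = nestDomain E (boundedNest E f) := by
  refine ⟨⟨⟨⟨nestDomain E (boundedNest E f), ?_⟩, ?_⟩, ?_⟩, rfl⟩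
  · rintro u v ⟨hu, M, hM, huM⟩ ⟨hv, N, hN, hvN⟩
    refine ⟨E.domain.add_mem hu hv, M ∪ N, union_mem_boundedNest hm hE hM hN, ?_⟩
    filter_upwards [huM, hvN, AEEqFun.coeFn_add u v] with x h1 h2 h3 hx
    rw [h3, Pi.add_apply, h1 fun h => hx (Or.inl h), h2 fun h => hx (Or.inr h), add_zero]
  · refine ⟨E.domain.zero_mem, ∅, ⟨MeasurableSet.empty, ⟨0, E.domain.zero_mem, ?_⟩, 0, by simp⟩, ?_⟩
    · filter_upwards [ae_coeFn_zero (m := m)] with x hx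
      simp [hx]
    · filter_upwards [ae_coeFn_zero (m := m)] with x hx _ using hx
  · rintro c u ⟨hu, M, hM, huM⟩
    refine ⟨E.domain.smul_mem c hu, M, hM, ?_⟩
    filter_upwards [huM, AEEqFun.coeFn_smul c u] with x h1 h2 hx
    rw [h2, Pi.smul_apply, h1 hx, smul_zero]

variable (hE' : IsEnergyForm E') (hext : E'.IsExtension E)
include hE' hext

/-- Subtracting a|f| from a bounded truncation of h forces f to be bounded where the result is
positive; subtracting a forces h ≥ a there. The result is dominated by |h| and lies in D(Ẽ), hence
in D(E) by the ideal property. -/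
theorem exists_nestDomain_approx
    (hideal : IsOrderIdealIn (E.domain : Set (X →ₘ[m] ℝ)) (E'.domain : Set (X →ₘ[m] ℝ)))
    {f h : X →ₘ[m] ℝ} (hf : f ∈ E'.domain) (hh : h ∈ E.domain) (n : ℕ) :
    ∃ u ∈ nestDomain E (boundedNest E f),
      (E u).toReal ≤ 8 * (E h).toReal + 2 * (E' |f|).toReal ∧
      ∀ᵐ x ∂m, u x = max (max (min (max (h x) 0) n - 1 / ((n : ℝ) + 1)) 0 -
        1 / ((n : ℝ) + 1) * |f x|) 0 := by
  set a : ℝ := 1 / ((n : ℝ) + 1) with ha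
  have ha0 : 0 < a := by positivity
  have ha1 : a ≤ 1 := by
    rw [ha, div_le_one (by positivity)]
    linarith [n.cast_nonneg (α := ℝ)]
  obtain ⟨hb1, hb2⟩ := hE.clamp hm hh (n.cast_nonneg (α := ℝ))
  obtain ⟨hk1, hk2⟩ := hE.excess hm hb1 ha0.le
  have hbx := ae_coeFn_clamp h (n : ℝ)
  generalize (h ⊔ 0) ⊓ AEEqFun.const X (n : ℝ) = b at *
  have hkx := ae_coeFn_excess b ha0.le
  generalize (b ⊔ 0) - (b ⊔ 0) ⊓ AEEqFun.const X a = k at *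
  have hfa := hE'.abs hm hf
  have hd := E'.domain.sub_mem (hext.1 hk1) (E'.domain.smul_mem a hfa)
  obtain ⟨hu1, hu2⟩ := hE'.posPart hm hd
  have hux : ∀ᵐ x ∂m, ((k - a • |f|) ⊔ 0) x =
      max (max (min (max (h x) 0) n - a) 0 - a * |f x|) 0 := by
    filter_upwards [hbx, hkx, ae_coeFn_posPart (k - a • |f|), AEEqFun.coeFn_sub k (a • |f|),
      AEEqFun.coeFn_smul a |f|, AEEqFun.coeFn_abs f] with x h1 h2 h3 h4 h5 h6
    rw [h3, h4, Pi.sub_apply, h2, h1, h5, Pi.smul_apply, h6, smul_eq_mul]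
  have huE : (k - a • |f|) ⊔ 0 ∈ E.domain := by
    refine hideal h hh _ hu1 (AEEqFun.coeFn_le.1 ?_)
    filter_upwards [hux, AEEqFun.coeFn_abs h, AEEqFun.coeFn_abs ((k - a • |f|) ⊔ 0)]
      with x h1 h2 h3
    rw [h3, h1, h2]
    have h4 : 0 ≤ a * |f x| := by positivity
    grind
  -- With a = 1/(n+1): positivity of `u` gives a|f| < n, whence the bound n(n+1), and h ≥ a gives
  -- (n+1)h⁺ ≥ 1.
  refine ⟨_, ⟨huE, {x | a ≤ h x} ∩ {x | |f x| ≤ n * (n + 1)}, ⟨?_, ?_, ?_⟩, ?_⟩, ?_, hux⟩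
  · exact (measurableSet_le measurable_const h.measurable).inter
      (measurableSet_le f.measurable.abs measurable_const)
  · refine ⟨((n : ℝ) + 1) • (h ⊔ 0), E.domain.smul_mem _ (hE.posPart hm hh).1, ?_⟩
    filter_upwards [AEEqFun.coeFn_smul ((n : ℝ) + 1) (h ⊔ 0), ae_coeFn_posPart h] with x h1 h2
    rw [h1, Pi.smul_apply, h2, smul_eq_mul]
    refine indicator_apply_le' (fun hx => ?_) (fun _ => by positivity)
    have h3 : a ≤ max (h x) 0 := le_max_of_le_left hx.1
    rw [ha, div_le_iff₀ (by positivity)] at h3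
    linarith
  · exact ⟨n * (n + 1), ae_of_all _ fun x hx => hx.2⟩
  · filter_upwards [hux] with x hx hxN
    rw [hx, max_eq_right]
    by_contra! hlt
    have h4 : 0 ≤ a * |f x| := by positivity
    have h5 : a * |f x| < min (max (h x) 0) n - a := by grind
    refine hxN ⟨?_, ?_⟩
    · change a ≤ h x
      grind
    · change |f x| ≤ n * (n + 1)
      have h6 : a * |f x| ≤ n := by linarith [min_le_right (max (h x) 0) (n : ℝ)]
      rw [ha, one_div, inv_mul_le_iff₀ (by positivity)] at h6
      linarith
  · rw [hext.2 _ huE]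
    have h1 := E'.toReal_sub_le (hext.1 hk1) (E'.domain.smul_mem a hfa)
    rw [E'.toReal_smul, ← hext.2 _ hk1] at h1
    have h2 : a ^ 2 * (E' |f|).toReal ≤ 1 * (E' |f|).toReal := by
      gcongr
      exact pow_le_one₀ ha0.le ha1
    linarith

omit hm hE hE' hext in
theorem tendsto_approx (t s : ℝ) : Tendsto (fun n : ℕ =>
    max (max (min (max t 0) n - 1 / ((n : ℝ) + 1)) 0 - 1 / ((n : ℝ) + 1) * s) 0)
    atTop (𝓝 (max t 0)) := by
  have h1 : Tendsto (fun n : ℕ => min (max t 0) (n : ℝ)) atTop (𝓝 (max t 0)) := by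
    refine tendsto_const_nhds.congr' ?_
    filter_upwards [tendsto_natCast_atTop_atTop.eventually_ge_atTop (max t 0)] with n hn
    rw [min_eq_left hn]
  have h2 := tendsto_one_div_add_atTop_nhds_zero_nat (𝕜 := ℝ)
  have h3 := ((((h1.sub h2).max (tendsto_const_nhds (x := (0 : ℝ)))).sub
    (h2.mul_const s)).max (tendsto_const_nhds (x := (0 : ℝ))))
  simpa using h3

/-- Approximating h⁺ and h⁻ separately gives a sequence of bounded energy converging a.e. to h; the
strong approximation result upgrades this to density in the form topology. -/
theorem isNest_boundedNest
    (hideal : IsOrderIdealIn (E.domain : Set (X →ₘ[m] ℝ)) (E'.domain : Set (X →ₘ[m] ℝ)))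
    {f : X →ₘ[m] ℝ} (hf : f ∈ E'.domain) : IsNest E (boundedNest E f) := by
  obtain ⟨W, hW⟩ := exists_submodule_boundedNest hm hE f
  refine ⟨fun N hN => hN.1, ⟨W, hW⟩, fun h => ?_⟩
  have hWE : W ≤ E.domain := fun u hu => by
    have : u ∈ (W : Set (X →ₘ[m] ℝ)) := hu
    rw [hW] at this
    exact this.1
  choose u hu huE hux using exists_nestDomain_approx hm hE hE' hext hideal hf h.2
  choose v hv hvE hvx using exists_nestDomain_approx hm hE hE' hext hideal hf
    (E.domain.neg_mem h.2)
  rw [← hW] at hu hv ⊢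
  have hlim : ∀ᵐ x ∂m, Tendsto (fun n => (u n - v n) x) atTop (𝓝 ((h : X →ₘ[m] ℝ) x)) := by
    filter_upwards [ae_all_iff.2 hux, ae_all_iff.2 hvx,
      ae_all_iff.2 fun n => AEEqFun.coeFn_sub (u n) (v n), AEEqFun.coeFn_neg (h : X →ₘ[m] ℝ)]
      with x h1 h2 h3 h4
    simp only [h3, Pi.sub_apply, h1, h2, h4, Pi.neg_apply]
    have h5 := (tendsto_approx ((h : X →ₘ[m] ℝ) x) |f x|).sub
      (tendsto_approx (-(h : X →ₘ[m] ℝ) x) |f x|)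
    have h6 : max ((h : X →ₘ[m] ℝ) x) 0 - max (-(h : X →ₘ[m] ℝ) x) 0 = (h : X →ₘ[m] ℝ) x := by
      grind
    rwa [h6] at h5
  obtain ⟨_, -, hcl⟩ := exists_mem_closure_of_ae_tendsto hm hE.closed (S := W)
    hWE (midpoint_mem W) (fun n => W.sub_mem (hu n) (hv n))
    (fun n => (E.toReal_sub_le (hWE (hu n)) (hWE (hv n))).trans
      (add_le_add (mul_le_mul_of_nonneg_left (huE n) zero_le_two)
        (mul_le_mul_of_nonneg_left (hvE n) zero_le_two))) hlim
  exact hcl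

omit hE' hext in
-- If g ≥ 1_N, then 2(g − 1/2)⁺ ≥ 1_N vanishes off {g ≥ 1/2}, which again belongs to the nest
-- because 2g⁺ ≥ 1 on it.
theorem exists_isSpecialNest : ∃ 𝒩 : Set (Set X), IsSpecialNest E 𝒩 := by
  refine ⟨boundedNest E 0, isNest_boundedNest hm hE hE ⟨le_rfl, fun _ _ => rfl⟩
    (fun _ _ _ hg _ => hg) E.domain.zero_mem, ?_⟩
  rintro N ⟨hN, ⟨g, hg, hNg⟩, -⟩
  obtain ⟨hw, -⟩ := hE.excess hm hg (one_half_pos (α := ℝ)).le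
  have hwx := ae_coeFn_excess g (one_half_pos (α := ℝ)).le
  generalize (g ⊔ 0) - (g ⊔ 0) ⊓ AEEqFun.const X (1 / 2 : ℝ) = w at *
  refine ⟨(2 : ℝ) • w, ⟨E.domain.smul_mem _ hw, {x | 1 / 2 ≤ g x},
    ⟨measurableSet_le measurable_const g.measurable, ⟨(2 : ℝ) • (g ⊔ 0),
      E.domain.smul_mem _ (hE.posPart hm hg).1, ?_⟩, 0, ?_⟩, ?_⟩, ?_⟩
  · filter_upwards [AEEqFun.coeFn_smul (2 : ℝ) (g ⊔ 0), ae_coeFn_posPart g] with x h1 h2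
    rw [h1, Pi.smul_apply, h2, smul_eq_mul]
    refine indicator_apply_le' (fun hx => ?_) (fun _ => by positivity)
    have h3 : 1 / 2 ≤ max (g x) 0 := le_max_of_le_left hx
    linarith
  · filter_upwards [ae_coeFn_zero (m := m)] with x hx _
    rw [hx, abs_zero]
  · filter_upwards [AEEqFun.coeFn_smul (2 : ℝ) w, hwx] with x h1 h2 hx
    have h3 : g x < 1 / 2 := not_le.1 hx
    rw [h1, Pi.smul_apply, h2, max_eq_right (by linarith), smul_zero]
  · filter_upwards [AEEqFun.coeFn_smul (2 : ℝ) w, hwx, hNg] with x h1 h2 h3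
    rw [h1, Pi.smul_apply, h2, smul_eq_mul]
    refine indicator_apply_le' (fun hx => ?_) (fun _ => by positivity)
    rw [indicator_of_mem hx] at h3
    linarith [le_max_left (g x - 1 / 2) 0]

/-- Elements of `D(Ẽ)` that are local on some nest and dominated by an element of `D(E)`. -/
theorem IsNest.mem_domain_of_le {𝒩 : Set (Set X)} (h𝒩 : IsNest E 𝒩) {f g : X →ₘ[m] ℝ}
    (hf : f ∈ E.domain) (hg : g ∈ E'.domain) (hloc : g ∈ localSpaceOn E 𝒩)
    (hle : ∀ᵐ x ∂m, 0 ≤ g x ∧ g x ≤ f x) : g ∈ E.domain := by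
  refine mem_domain_of_locDist hm hE.closed
    (c := 6 * (E' g).toReal + 4 * (2 + 2 * (E f).toReal)) fun U hU hfin ε hε => ?_
  obtain ⟨⟨u, huE⟩, hu, hud, hEu⟩ := exists_approx_of_mem_closure (h𝒩.dense ⟨f, hf⟩) hU hfin hε
  obtain ⟨-, N, hN, huN⟩ := hu
  obtain ⟨w, hw, hgw⟩ := hloc N hN
  simp only at hud hEu huN
  obtain ⟨hp, hpE⟩ := hE.posPart hm huE
  -- On `N` the functions `g` and `w` agree; off `N`, u = 0 and g ≥ 0, so both infima vanish. Hence
  -- g ∧ u⁺ = w⁺ ∧ u⁺.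
  have hmem : g ⊓ (u ⊔ 0) ∈ E.domain := by
    convert (hE.inf hm (hE.posPart hm hw).1 hp).1 using 1
    refine AEEqFun.ext ?_
    filter_upwards [hle, huN, hgw, ae_coeFn_posPart u, ae_coeFn_posPart w,
      AEEqFun.coeFn_inf g (u ⊔ 0), AEEqFun.coeFn_inf (w ⊔ 0) (u ⊔ 0)] with x h1 h2 h3 h4 h5 h6 h7
    rw [h6, h7, h4, h5]
    by_cases hx : x ∈ N
    · rw [← h3 hx, max_eq_left h1.1]
    · rw [h2 hx, max_self, inf_of_le_right h1.1, inf_of_le_right (le_max_right _ _)]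
  refine ⟨_, hmem, ?_, ?_⟩
  · rw [hext.2 _ hmem]
    have h1 := (hE'.inf hm hg (hext.1 hp)).2
    rw [← hext.2 _ hp] at h1
    have h2 := E.toReal_add_le (E.domain.sub_mem huE hf) hf
    rw [sub_add_cancel] at h2
    linarith
  -- Since 0 ≤ g ≤ f, |g ∧ u⁺ − g| ≤ |u − f| pointwise.
  · refine (locDist_mono hfin ?_).trans_lt hud
    filter_upwards [hle, ae_coeFn_posPart u, AEEqFun.coeFn_inf g (u ⊔ 0)] with x h1 h2 h3
    rw [h3, h2]
    grind

omit hext in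
theorem isOrderIdealIn_of_nonneg
    (h : ∀ f ∈ E.domain, ∀ g ∈ E'.domain, (∀ᵐ x ∂m, 0 ≤ g x ∧ g x ≤ f x) → g ∈ E.domain) :
    IsOrderIdealIn (E.domain : Set (X →ₘ[m] ℝ)) (E'.domain : Set (X →ₘ[m] ℝ)) := by
  intro f hf g hg hle
  have hpos : ∀ g ∈ E'.domain, (∀ᵐ x ∂m, |g x| ≤ |f x|) → g ⊔ 0 ∈ E.domain := by
    intro g hg hgf
    refine h |f| (hE.abs hm hf) _ (hE'.posPart hm hg).1 ?_
    filter_upwards [hgf, ae_coeFn_posPart g, AEEqFun.coeFn_abs f] with x h1 h2 h3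
    rw [h2, h3]
    exact ⟨le_max_right _ _, max_le ((le_abs_self _).trans h1) (abs_nonneg _)⟩
  have hgf : ∀ᵐ x ∂m, |g x| ≤ |f x| := by
    have hle' : ⇑|g| ≤ᵐ[m] ⇑|f| := AEEqFun.coeFn_le.2 hle
    filter_upwards [hle', AEEqFun.coeFn_abs f, AEEqFun.coeFn_abs g]
      with x h1 h2 h3
    rwa [h2, h3] at h1
  have h1 := hpos g hg hgf
  have h2 := hpos (-g) (E'.domain.neg_mem hg) (by
    filter_upwards [hgf, AEEqFun.coeFn_neg g] with x h1 h2
    rwa [h2, Pi.neg_apply, abs_neg])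
  have h3 := E.domain.sub_mem h1 h2
  have h4 : g = (g ⊔ 0) - (-g ⊔ 0) := by
    refine AEEqFun.ext ?_
    filter_upwards [AEEqFun.coeFn_sub (g ⊔ 0) (-g ⊔ 0), ae_coeFn_posPart g, ae_coeFn_posPart (-g),
      AEEqFun.coeFn_neg g] with x h1 h2 h3 h4
    rw [h1, Pi.sub_apply, h2, h3, h4, Pi.neg_apply]
    grind
  rw [h4]
  exact h3

/-! ### The implications between the characterizations of Silverstein extensions -/

omit hE hext in
theorem IsOrderIdealIn.isAlgebraicIdealIn (hext : E'.IsExtension E)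
    (hideal : IsOrderIdealIn (E.domain : Set (X →ₘ[m] ℝ)) (E'.domain : Set (X →ₘ[m] ℝ))) :
    IsAlgebraicIdealIn ((E.domain : Set (X →ₘ[m] ℝ)) ∩ essBounded m)
      ((E'.domain : Set (X →ₘ[m] ℝ)) ∩ essBounded m) := by
  rintro f ⟨hf, hfb⟩ g ⟨hg, hgb⟩
  obtain ⟨K, hK⟩ := mem_essBounded_iff.1 hfb
  obtain ⟨L, hL⟩ := mem_essBounded_iff.1 hgb
  refine ⟨hideal (L • f) (E.domain.smul_mem L hf) _ (hE'.mul hm (hext.1 hf) hg hK hL)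
    (AEEqFun.coeFn_le.1 ?_), mem_essBounded_iff.2 ⟨K * L, ?_⟩⟩
  · filter_upwards [hL, AEEqFun.coeFn_abs (f * g), AEEqFun.coeFn_abs (L • f),
      AEEqFun.coeFn_mul f g, AEEqFun.coeFn_smul L f] with x h1 h2 h3 h4 h5
    rw [h2, h3, h4, h5, Pi.mul_apply, Pi.smul_apply, smul_eq_mul, abs_mul, abs_mul, mul_comm]
    exact mul_le_mul_of_nonneg_right (h1.trans (le_abs_self L)) (abs_nonneg _)
  · filter_upwards [hK, hL, AEEqFun.coeFn_mul f g] with x h1 h2 h3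
    rw [h3, Pi.mul_apply, abs_mul]
    exact mul_le_mul h1 h2 (abs_nonneg _) ((abs_nonneg _).trans h1)

omit hE' hext in
theorem IsAlgebraicIdealIn.subset_localSpaceOn
    (hideal : IsAlgebraicIdealIn ((E.domain : Set (X →ₘ[m] ℝ)) ∩ essBounded m)
      ((E'.domain : Set (X →ₘ[m] ℝ)) ∩ essBounded m))
    {𝒩 : Set (Set X)} (h𝒩 : IsSpecialNest E 𝒩) :
    (E'.domain : Set (X →ₘ[m] ℝ)) ∩ essBounded m ⊆ localSpaceOn E 𝒩 := by
  intro f hf N hN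
  -- The clamp of `g` to [0, 1] equals 1 on `N`, so its product with `f` is the required local
  -- representative.
  obtain ⟨g, ⟨hg, -⟩, hNg⟩ := h𝒩.exists_ge_one N hN
  obtain ⟨hc, -⟩ := hE.clamp hm hg zero_le_one
  have hcb : (g ⊔ 0) ⊓ AEEqFun.const X 1 ∈ essBounded m := mem_essBounded_iff.2 ⟨1, by
    filter_upwards [ae_coeFn_clamp g 1] with x hx
    rw [hx, abs_of_nonneg (le_min (le_max_right _ _) zero_le_one)]
    exact min_le_right _ _⟩
  refine ⟨_, (hideal _ ⟨hc, hcb⟩ f hf).1, ?_⟩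
  filter_upwards [hNg, ae_coeFn_clamp g 1,
    AEEqFun.coeFn_mul ((g ⊔ 0) ⊓ AEEqFun.const X 1) f] with x h1 h2 h3 hx
  rw [indicator_of_mem hx] at h1
  rw [h3, Pi.mul_apply, h2, min_eq_right (le_max_of_le_left h1), one_mul]

theorem IsOrderIdealIn.subset_localSpace
    (hideal : IsOrderIdealIn (E.domain : Set (X →ₘ[m] ℝ)) (E'.domain : Set (X →ₘ[m] ℝ))) :
    (E'.domain : Set (X →ₘ[m] ℝ)) ⊆ localSpace E := by
  intro f hf
  refine ⟨boundedNest E f, isNest_boundedNest hm hE hE' hext hideal hf, ?_⟩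
  rintro N ⟨-, ⟨g, hg, hNg⟩, K, hK⟩
  have hG := E.domain.smul_mem |K| (hE.posPart hm hg).1
  have hGx : ∀ᵐ x ∂m, (|K| • (g ⊔ 0)) x = |K| * max (g x) 0 := by
    filter_upwards [AEEqFun.coeFn_smul |K| (g ⊔ 0), ae_coeFn_posPart g] with x h1 h2
    rw [h1, Pi.smul_apply, h2, smul_eq_mul]
  generalize |K| • (g ⊔ 0) = G at *
  -- This is `f` truncated to [−G, G]: dominated by G ∈ D(E), and equal to `f` on `N`, where G ≥ |K|
  -- ≥ |f|.
  have hw : -(-(f ⊓ G) ⊓ G) ∈ E'.domain := E'.domain.neg_mem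
    (hE'.inf hm (E'.domain.neg_mem (hE'.inf hm hf (hext.1 hG)).1) (hext.1 hG)).1
  have hwx : ∀ᵐ x ∂m, (-(-(f ⊓ G) ⊓ G)) x = -min (-min (f x) (G x)) (G x) := by
    filter_upwards [AEEqFun.coeFn_neg (-(f ⊓ G) ⊓ G), AEEqFun.coeFn_inf (-(f ⊓ G)) G,
      AEEqFun.coeFn_neg (f ⊓ G), AEEqFun.coeFn_inf f G] with x h1 h2 h3 h4
    rw [h1, Pi.neg_apply, h2, h3, Pi.neg_apply, h4]
  refine ⟨_, hideal G hG _ hw (AEEqFun.coeFn_le.1 ?_), ?_⟩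
  · filter_upwards [hwx, hGx, AEEqFun.coeFn_abs G, AEEqFun.coeFn_abs (-(-(f ⊓ G) ⊓ G))]
      with x h1 h2 h3 h4
    have h5 : 0 ≤ G x := by rw [h2]; positivity
    rw [h4, h3, h1, abs_of_nonneg h5, abs_le]
    grind
  · filter_upwards [hwx, hGx, hNg, hK] with x h1 h2 h3 h4 hx
    rw [indicator_of_mem hx] at h3
    have h5 : |f x| ≤ G x := by
      rw [h2]
      calc |f x| ≤ K := h4 hx
        _ ≤ |K| := le_abs_self K
        _ = |K| * 1 := (mul_one _).symm
        _ ≤ |K| * max (g x) 0 := by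
          gcongr
          exact le_max_of_le_left h3
    obtain ⟨h6, h7⟩ := abs_le.1 h5
    rw [h1, min_eq_left h7, min_eq_left (by linarith), neg_neg]

theorem isOrderIdealIn_of_subset_localSpace
    (h : (E'.domain : Set (X →ₘ[m] ℝ)) ⊆ localSpace E) :
    IsOrderIdealIn (E.domain : Set (X →ₘ[m] ℝ)) (E'.domain : Set (X →ₘ[m] ℝ)) := by
  refine isOrderIdealIn_of_nonneg hm hE hE' fun f hf g hg hle => ?_
  obtain ⟨𝒩, h𝒩, hloc⟩ := h hg
  exact h𝒩.mem_domain_of_le hm hE hE' hext hf hg hloc hle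

/-- The truncations g ∧ n are bounded, so domination puts them in D(E). Their energies stay below
Ẽ(g), and lower semicontinuity of E yields g. -/
theorem isOrderIdealIn_of_inter_essBounded_subset {𝒩 : Set (Set X)} (h𝒩 : IsNest E 𝒩)
    (h : (E'.domain : Set (X →ₘ[m] ℝ)) ∩ essBounded m ⊆ localSpaceOn E 𝒩) :
    IsOrderIdealIn (E.domain : Set (X →ₘ[m] ℝ)) (E'.domain : Set (X →ₘ[m] ℝ)) := by
  refine isOrderIdealIn_of_nonneg hm hE hE' fun f hf g hg hle => ?_
  have hmem : ∀ n : ℕ, (g ⊔ 0) ⊓ AEEqFun.const X (n : ℝ) ∈ E.domain := by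
    intro n
    obtain ⟨hc, -⟩ := hE'.clamp hm hg (n.cast_nonneg (α := ℝ))
    refine h𝒩.mem_domain_of_le hm hE hE' hext hf hc (h ⟨hc, mem_essBounded_iff.2 ⟨n, ?_⟩⟩) ?_
    · filter_upwards [ae_coeFn_clamp g (n : ℝ)] with x hx
      rw [hx, abs_of_nonneg (le_min (le_max_right _ _) n.cast_nonneg)]
      exact min_le_right _ _
    · filter_upwards [ae_coeFn_clamp g (n : ℝ), hle] with x hx hgf
      rw [hx, max_eq_left hgf.1]
      exact ⟨le_min hgf.1 n.cast_nonneg, (min_le_left _ _).trans hgf.2⟩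
  refine (mem_domain_of_ae_tendsto hm hE.closed (c := (E' g).toReal) hmem (fun n => ?_) ?_).1
  · rw [hext.2 _ (hmem n)]
    exact (hE'.clamp hm hg n.cast_nonneg).2
  · filter_upwards [hle, ae_all_iff.2 fun n : ℕ => ae_coeFn_clamp g (n : ℝ)] with x h1 h2
    refine tendsto_const_nhds.congr' ?_
    filter_upwards [tendsto_natCast_atTop_atTop.eventually_ge_atTop (g x)] with n hn
    rw [h2, max_eq_left h1.1, min_eq_left hn]

end Nests

end EnergyForm

end

/-! ### The equivalence theorem -/

open EnergyForm
theorem mainTheorem3 {X : Type*} [MeasurableSpace X] (m : Measure X) (hm : IsLocalizable m)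
    (E E' : QForm (X →ₘ[m] ℝ)) (hE : IsEnergyForm E) (hE' : IsEnergyForm E')
    (hext : E'.IsExtension E) :
    List.TFAE [
      IsOrderIdealIn (E.domain : Set (X →ₘ[m] ℝ)) (E'.domain : Set (X →ₘ[m] ℝ)),
      IsAlgebraicIdealIn ((E.domain : Set (X →ₘ[m] ℝ)) ∩ essBounded m)
        ((E'.domain : Set (X →ₘ[m] ℝ)) ∩ essBounded m),
      (E'.domain : Set (X →ₘ[m] ℝ)) ⊆ localSpace E,
      ∃ 𝒩 : Set (Set X), IsSpecialNest E 𝒩 ∧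
        (E'.domain : Set (X →ₘ[m] ℝ)) ∩ essBounded m ⊆ localSpaceOn E 𝒩,
      ∀ 𝒩 : Set (Set X), IsSpecialNest E 𝒩 →
        (E'.domain : Set (X →ₘ[m] ℝ)) ∩ essBounded m ⊆ localSpaceOn E 𝒩] := by
  tfae_have 1 → 2 := fun h => h.isAlgebraicIdealIn hm hE' hext
  tfae_have 2 → 5 := fun h _ h𝒩 => h.subset_localSpaceOn hm hE h𝒩
  tfae_have 5 → 4 := fun h => by
    obtain ⟨𝒩, h𝒩⟩ := exists_isSpecialNest hm hE
    exact ⟨𝒩, h𝒩, h 𝒩 h𝒩⟩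
  tfae_have 4 → 1 := fun ⟨_, h𝒩, h⟩ =>
    isOrderIdealIn_of_inter_essBounded_subset hm hE hE' hext h𝒩.toIsNest h
  tfae_have 1 → 3 := fun h => h.subset_localSpace hm hE hE' hext
  tfae_have 3 → 1 := fun h => isOrderIdealIn_of_subset_localSpace hm hE hE' hext h
  tfae_finish
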